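/- Let $n\ge 2$ be an integer and $\mathbf{k}=(k_1,\dots,k_n)$ with integers $k_i\ge 2$. Let $V(n,\mathbf{k})=\prod_{i=1}^n\{1,\dots,k_i\}$. The directed Hamming graph on $V(n,\mathbf{k})$ has edges $u\to v$ and $v\to u$ whenever $u$ and $v$ differ in exactly one coordinate. A line in coordinate $i$ is a set of $k_i$ vertices that pairwise differ in exactly the $i$th coordinate, and a line is a line in some coordinate. Let $\vec{L}(n,\mathbf{k})$ be the random subgraph of the directed Hamming graph obtained by choosing, independently for all lines, a uniformly random vertex of the line (its winner), and keeping within each line exactly those edges $u\to v$ for which $v$ is the winner. A vertex is a sink if it has no outgoing edges, and $u$ can reach $v$ (equivalently, $v$ can be reached from $u$) if there is a directed path from $u$ to $v$, possibly of length $0$; so every vertex can be reached from itself. **Theorem.** For every $\varepsilon>0$ there exist $c,\delta>0$ (depending only on $\varepsilon$) such that for all integers $n\ge 2$ and all $\mathbf{k}\in\{2,3,\dots\}^n$, if $K:=\max_i k_i$ satisfies $K\le \delta\sqrt{n/\log n}$, then, with failure probability at most $\prod_{i=1}^n k_i^{-c}$, every vertex of $\vec{L}(n,\mathbf{k})$ can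 be reached from at most $(1+\varepsilon)K\log K$ vertices or can be reached from every non-sink. Here $\log$ is the natural logarithm. -/

import Mathlib

open MeasureTheory ProbabilityTheory

noncomputable section

namespace DirectedGrid

/-- The vertex set `V(n, k) = [k₁] × ⋯ × [kₙ]`. -/
abbrev Vertex {n : ℕ} (k : Fin n → ℕ) : Type := (i : Fin n) → Fin (k i)

/-- The vertices `u` and `v` differ in the `i`th coordinate and in no other coordinate. -/
def DifferExactlyAt {n : ℕ} {k : Fin n → ℕ} (i : Fin n) (u v : Vertex k) : Prop :=
  ∀ j, u j ≠ v j ↔ j = i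

/-- The directed Hamming graph: there are edges `u → v` and `v → u` precisely when `u` and `v`
differ in exactly one coordinate. -/
def directedHamming {n : ℕ} (k : Fin n → ℕ) : Digraph (Vertex k) where
  Adj u v := ∃ i, DifferExactlyAt i u v

/-- A line in coordinate `i`: a set of `k i` vertices which pairwise differ in exactly the `i`th
coordinate. -/
def IsLineInCoord {n : ℕ} {k : Fin n → ℕ} (i : Fin n) (S : Finset (Vertex k)) : Prop :=
  S.card = k i ∧ (S : Set (Vertex k)).Pairwise (DifferExactlyAt i)

/-- The type of lines of `V(n, k)`. -/
def Line {n : ℕ} (k : Fin n → ℕ) : Type := {S : Finset (Vertex k) // ∃ i, IsLineInCoord i S}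

instance {n : ℕ} (k : Fin n → ℕ) : Finite (Line k) := by
  unfold Line; infer_instance

instance {n : ℕ} (k : Fin n → ℕ) : Fintype (Line k) := Fintype.ofFinite _

/-- The vertices lying on a given line. -/
abbrev Line.Point {n : ℕ} {k : Fin n → ℕ} (l : Line k) : Type := {v : Vertex k // v ∈ l.1}

/-- The sample space: a choice, for each line, of one of the vertices of the line (its winner). -/
abbrev Winners {n : ℕ} (k : Fin n → ℕ) : Type := (l : Line k) → l.Point

/-- The law of the winners: independently for each line, a uniformly random vertex of the line. -/
def winnersLaw {n : ℕ} (k : Fin n → ℕ) : Measure (Winners k) :=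
  Measure.pi fun l : Line k => uniformOn (Set.univ : Set l.Point)

/-- The subgraph of the directed Hamming graph determined by the winners: within each line, keep
only those edges which point to the winner of that line. -/
def winnerGraph {n : ℕ} {k : Fin n → ℕ} (w : Winners k) : Digraph (Vertex k) where
  Adj u v := (directedHamming k).Adj u v ∧ ∃ l : Line k, u ∈ l.1 ∧ v ∈ l.1 ∧ (w l : Vertex k) = v

/-- `u` can reach `v` along a (possibly trivial) directed path. -/
def CanReach {V : Type*} (G : Digraph V) (u v : V) : Prop := Relation.ReflTransGen G.Adj u v

/-- A sink is a vertex with no outgoing edges. -/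
def IsSink {V : Type*} (G : Digraph V) (v : V) : Prop := ∀ u, ¬ G.Adj v u

/-- Every vertex of `G` can either be reached from at most `N` vertices (counting itself), or can
be reached from every non-sink. -/
def WellConnected {V : Type*} (G : Digraph V) (N : ℝ) : Prop :=
  ∀ v, ({u | CanReach G u v}.ncard : ℝ) ≤ N ∨ ∀ u, ¬ IsSink G u → CanReach G u v

/-- The law of the winners is a probability measure. -/
theorem isProbabilityMeasure_winnersLaw {n : ℕ} {k : Fin n → ℕ} (hk : ∀ i, 2 ≤ k i) :
    IsProbabilityMeasure (winnersLaw k) := by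
  have h : ∀ l : Line k, Nonempty l.Point := by
    rintro ⟨S, i, hS⟩
    have hpos : 0 < S.card := by
      rw [hS.1]
      exact lt_of_lt_of_le two_pos (hk i)
    obtain ⟨v, hv⟩ := Finset.card_pos.mp hpos
    exact ⟨⟨v, hv⟩⟩
  unfold winnersLaw
  infer_instance

end DirectedGrid

end

/-! Write Λ = ∑ log k_i, so that there are exp Λ vertices. Almost every vertex is "good", and good
vertices reach one another; it remains to see that the descendants of a non-sink, and any large set
of ancestors, contain a good vertex.

Local structure: an edge changing coordinate i can be replaced by a three-step detour through any
other coordinate j. The n - 1 detours are independent and each is open with probability at least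
1/(2K²), so all fail with probability at most n^(-C), where C is large because K² log n is small
compared with n (`prob_not_linked_le`). A vertex is good if every edge starting within distance 4 of
it has an open detour. Two good vertices are joined by n/4 independent routes whose ends lie in
these balls, so with high probability every good vertex reaches every other
(`prob_exists_good_not_canReach_le`).

Escape from small balls: if S is a set of descendants in a ball of radius R much smaller than Λ /
log K, most lines through S meet it once, and each such line must be won inside S. This costs about
exp(-Λ) per vertex, so two vertices already beat the exp Λ choices of a starting point. For
ancestors each such line must be won outside S, which costs about exp(-Λ/(K log K)) per vertex, so
more than (1 + ε) K log K vertices are needed; this is the source of the threshold. Connected sets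
are counted by walks (`prob_exists_connected_le`).

A connected set leaving the ball contains many vertices at mutual distance at least 12, whose
goodness is independent, so one of them is good (`prob_exists_not_good_le`,
`ConnectedFrom.exists_good`). A path then runs from the non-sink to a good descendant, to a good
ancestor, to the target. -/

/-! ### Independence of events on disjoint coordinates of a product space. -/

theorem dependsOn_iInter_mem {ι : Type*} {X : ι → Type*} {J : Type*} (s : Finset J) (E : J → Set (∀ i, X i))
    (T : J → Set ι) (hE : ∀ j ∈ s, DependsOn (fun w => w ∈ E j) (T j)) :
    DependsOn (fun w => w ∈ ⋂ j ∈ s, E j) (⋃ j ∈ s, T j) := by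
  intro w w' h
  simp only [Set.mem_iInter, eq_iff_iff]
  refine forall₂_congr fun j hj => ?_
  exact Iff.of_eq (hE j hj fun i hi => h i (Set.mem_biUnion hj hi))

section ProductMeasure

variable {ι : Type*} [Fintype ι] {X : ι → Type*} [∀ i, MeasurableSpace (X i)]
  [∀ i, Finite (X i)] [∀ i, MeasurableSingletonClass (X i)]

/-- Events of a product space which depend on disjoint sets of coordinates are independent. -/
theorem measure_pi_inter_of_dependsOn (μ : ∀ i, Measure (X i)) [∀ i, IsProbabilityMeasure (μ i)]
    {E F : Set (∀ i, X i)} {S T : Set ι} (hST : Disjoint S T)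
    (hE : DependsOn (fun w => w ∈ E) S) (hF : DependsOn (fun w => w ∈ F) T) :
    (Measure.pi μ) (E ∩ F) = (Measure.pi μ) E * (Measure.pi μ) F := by
  classical
  have hind : iIndepFun (fun i (w : ∀ i, X i) => w i) (Measure.pi μ) :=
    iIndepFun_pi (X := fun i => (id : X i → X i)) fun i => aemeasurable_id
  have h := hind.indepFun_finset S.toFinset T.toFinset (by simpa using hST)
    fun i => measurable_pi_apply i
  -- An event depending only on the coordinates in `S` is the preimage of its image under
  -- restriction to `S`.
  have key : ∀ (E : Set (∀ i, X i)) (S : Set ι), DependsOn (fun w => w ∈ E) S →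
      E = (fun w (i : S.toFinset) => w i) ⁻¹' ((fun w (i : S.toFinset) => w i) '' E) := by
    intro E S hE
    apply Set.Subset.antisymm (Set.subset_preimage_image _ _)
    rintro w ⟨w', hw', hww'⟩
    have : (w' ∈ E) = (w ∈ E) := hE fun i hi => congrFun hww' ⟨i, by simpa using hi⟩
    exact this ▸ hw'
  have := h.measure_inter_preimage_eq_mul _ _
    (Set.toFinite ((fun w (i : S.toFinset) => w i) '' E)).measurableSet
    (Set.toFinite ((fun w (i : T.toFinset) => w i) '' F)).measurableSet
  rwa [← key E S hE, ← key F T hF] at this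

/-- Finite families of events which depend on pairwise disjoint sets of coordinates are
independent. -/
theorem measureReal_pi_biInter_of_dependsOn (μ : ∀ i, Measure (X i))
    [∀ i, IsProbabilityMeasure (μ i)] {J : Type*} (s : Finset J) (E : J → Set (∀ i, X i))
    (T : J → Set ι) (hE : ∀ j ∈ s, DependsOn (fun w => w ∈ E j) (T j))
    (hT : (s : Set J).PairwiseDisjoint T) :
    (Measure.pi μ).real (⋂ j ∈ s, E j) = ∏ j ∈ s, (Measure.pi μ).real (E j) := by
  classical
  induction s using Finset.induction_on with
  | empty => simp
  | insert a s ha ih =>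
    rw [Finset.prod_insert ha, Finset.set_biInter_insert, ← ih
      (fun j hj => hE j (Finset.mem_insert_of_mem hj)) (hT.subset (by simp))]
    simp only [measureReal_def, ← ENNReal.toReal_mul]
    congr 1
    refine measure_pi_inter_of_dependsOn μ ?_ (hE a (Finset.mem_insert_self _ _))
      (dependsOn_iInter_mem s E T fun j hj => hE j (Finset.mem_insert_of_mem hj))
    rw [Set.disjoint_iUnion₂_right]
    intro j hj
    exact hT (by simp) (by simp [hj]) (by rintro rfl; exact ha hj)

end ProductMeasure

/-! ### Lines, winners and edges in coordinates. -/

namespace DirectedGrid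

variable {n : ℕ} {k : Fin n → ℕ}

/-- The line in coordinate `i` through the vertex `v`. -/
noncomputable def lineThrough (i : Fin n) (v : Vertex k) : Line k :=
  ⟨Finset.univ.image (fun a => Function.update v i a), i, by
    rw [Finset.card_image_of_injective _ (Function.update_injective v i), Finset.card_univ,
      Fintype.card_fin], by
    intro x hx y hy hxy j
    simp only [Finset.coe_image, Finset.coe_univ, Set.image_univ, Set.mem_range] at hx hy
    obtain ⟨a, rfl⟩ := hx
    obtain ⟨b, rfl⟩ := hy
    by_cases hj : j = i
    · subst hj
      simp only [Function.update_self, iff_true]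
      rintro rfl
      exact hxy rfl
    · simp [hj]⟩

theorem mem_lineThrough {i : Fin n} {u v : Vertex k} :
    u ∈ (lineThrough i v).1 ↔ ∀ j, j ≠ i → u j = v j := by
  simp only [lineThrough, Finset.mem_image, Finset.mem_univ, true_and]
  constructor
  · rintro ⟨a, rfl⟩ j hj
    simp [hj]
  · intro h
    refine ⟨u i, ?_⟩
    ext j
    by_cases hj : j = i
    · subst hj; simp
    · simp [hj, h j hj]

theorem self_mem_lineThrough (i : Fin n) (v : Vertex k) : v ∈ (lineThrough i v).1 :=
  mem_lineThrough.2 fun _ _ => rfl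

/-- A line has at least two points because `2 ≤ k i`, so it determines its own coordinate. -/
theorem lineThrough_eq_iff (hk : ∀ i, 2 ≤ k i) {i j : Fin n} {u v : Vertex k} :
    lineThrough i u = lineThrough j v ↔ i = j ∧ ∀ l, l ≠ i → u l = v l := by
  constructor
  · intro h
    have hij : i = j := by
      by_contra hij
      have : Nontrivial (Fin (k i)) := Fin.nontrivial_iff_two_le.2 (hk i)
      obtain ⟨a, ha⟩ := exists_ne (u i)
      have h1 : Function.update u i a ∈ (lineThrough i u).1 :=
        mem_lineThrough.2 fun l hl => by simp [hl]
      have h2 := self_mem_lineThrough i u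
      rw [h] at h1 h2
      have e1 := mem_lineThrough.1 h1 i hij
      have e2 := mem_lineThrough.1 h2 i hij
      rw [Function.update_self] at e1
      exact ha (e1.trans e2.symm)
    subst hij
    refine ⟨rfl, mem_lineThrough.1 ?_⟩
    rw [← h]
    exact self_mem_lineThrough i u
  · rintro ⟨rfl, h⟩
    apply Subtype.ext
    ext x
    rw [mem_lineThrough, mem_lineThrough]
    exact forall₂_congr fun l hl => by rw [h l hl]

theorem card_lineThrough (i : Fin n) (v : Vertex k) : (lineThrough i v).1.card = k i := by
  rw [lineThrough, Finset.card_image_of_injective _ (Function.update_injective v i),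
    Finset.card_univ, Fintype.card_fin]

theorem exists_eq_lineThrough (l : Line k) {v : Vertex k} (hv : v ∈ l.1) :
    ∃ i, l = lineThrough i v := by
  obtain ⟨S, i, hcard, hS⟩ := l
  refine ⟨i, Subtype.ext (Finset.eq_of_subset_of_card_le ?_ ?_)⟩
  · intro u hu
    refine mem_lineThrough.2 fun j hj => ?_
    by_cases huv : u = v
    · rw [huv]
    · by_contra hne
      exact hj ((hS hu hv huv j).1 hne)
  · rw [card_lineThrough, hcard]

/-- The `i`th coordinate of the winner of the line in coordinate `i` through `v`. -/
noncomputable def winCoord (w : Winners k) (i : Fin n) (v : Vertex k) : Fin (k i) :=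
  (w (lineThrough i v) : Vertex k) i

theorem coe_winner (w : Winners k) (i : Fin n) (v : Vertex k) :
    (w (lineThrough i v) : Vertex k) = Function.update v i (winCoord w i v) := by
  ext j
  by_cases hj : j = i
  · subst hj; simp [winCoord]
  · rw [Function.update_of_ne hj, mem_lineThrough.1 (w (lineThrough i v)).2 j hj]

theorem differExactlyAt_update {i : Fin n} {u : Vertex k} {a : Fin (k i)} (h : a ≠ u i) :
    DifferExactlyAt i u (Function.update u i a) := by
  intro j
  by_cases hj : j = i
  · subst hj; simpa using h.symm
  · simp [hj]

theorem adj_update {w : Winners k} {i : Fin n} {u : Vertex k} {a : Fin (k i)} (h : a ≠ u i)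
    (hw : winCoord w i u = a) : (winnerGraph w).Adj u (Function.update u i a) := by
  refine ⟨⟨i, differExactlyAt_update h⟩, lineThrough i u, self_mem_lineThrough i u, ?_, ?_⟩
  · exact mem_lineThrough.2 fun j hj => by simp [hj]
  · rw [coe_winner, hw]

theorem exists_eq_update_of_adj {w : Winners k} {u v : Vertex k} (h : (winnerGraph w).Adj u v) :
    ∃ i, v = Function.update u i (winCoord w i u) ∧ winCoord w i u ≠ u i := by
  obtain ⟨⟨i', hi'⟩, l, hu, hv, hw⟩ := h
  obtain ⟨i, rfl⟩ := exists_eq_lineThrough l hu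
  rw [coe_winner] at hw
  refine ⟨i, hw.symm, fun h => ?_⟩
  rw [h, Function.update_eq_self] at hw
  exact (hi' i').2 rfl (by rw [hw])

theorem nonempty_point (hk : ∀ i, 2 ≤ k i) (l : Line k) : Nonempty l.Point := by
  obtain ⟨S, i, hS⟩ := l
  have hpos : 0 < S.card := by
    rw [hS.1]
    exact lt_of_lt_of_le two_pos (hk i)
  obtain ⟨v, hv⟩ := Finset.card_pos.mp hpos
  exact ⟨⟨v, hv⟩⟩

theorem dependsOn_inter {ι : Type*} {X : ι → Type*} {E F : Set (∀ i, X i)} {S T : Set ι}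
    (hE : DependsOn (fun w => w ∈ E) S) (hF : DependsOn (fun w => w ∈ F) T) :
    DependsOn (fun w => w ∈ E ∩ F) (S ∪ T) := by
  intro w w' h
  exact congrArg₂ And (hE fun i hi => h i (Or.inl hi)) (hF fun i hi => h i (Or.inr hi))

theorem dependsOn_compl {ι : Type*} {X : ι → Type*} {E : Set (∀ i, X i)} {S : Set ι}
    (hE : DependsOn (fun w => w ∈ E) S) : DependsOn (fun w => w ∈ Eᶜ) S := by
  intro w w' h
  exact congrArg Not (hE h)

theorem prob_inter_of_dependsOn (hk : ∀ i, 2 ≤ k i) {E F : Set (Winners k)} {S T : Set (Line k)}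
    (hST : Disjoint S T) (hE : DependsOn (fun w => w ∈ E) S)
    (hF : DependsOn (fun w => w ∈ F) T) :
    (winnersLaw k).real (E ∩ F) = (winnersLaw k).real E * (winnersLaw k).real F := by
  have := nonempty_point hk
  simp only [measureReal_def, ← ENNReal.toReal_mul]
  congr 1
  exact measure_pi_inter_of_dependsOn _ hST hE hF

theorem prob_biInter_of_dependsOn (hk : ∀ i, 2 ≤ k i) {J : Type*} (s : Finset J)
    (E : J → Set (Winners k)) (T : J → Set (Line k))
    (hE : ∀ j ∈ s, DependsOn (fun w => w ∈ E j) (T j)) (hT : (s : Set J).PairwiseDisjoint T) :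
    (winnersLaw k).real (⋂ j ∈ s, E j) = ∏ j ∈ s, (winnersLaw k).real (E j) := by
  have := nonempty_point hk
  exact measureReal_pi_biInter_of_dependsOn _ s E T hE hT

theorem dependsOn_winCoord (i : Fin n) (v : Vertex k) (a : Fin (k i)) :
    DependsOn (fun w => w ∈ {w : Winners k | winCoord w i v = a}) {lineThrough i v} := by
  intro w w' h
  simp only [Set.mem_ofPred_eq, winCoord, h _ rfl]

theorem prob_winCoord_eq (hk : ∀ i, 2 ≤ k i) (i : Fin n) (v : Vertex k) (a : Fin (k i)) :
    (winnersLaw k).real {w | winCoord w i v = a} = 1 / k i := by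
  classical
  have := nonempty_point hk
  have hp : Function.update v i a ∈ (lineThrough i v).1 :=
    mem_lineThrough.2 fun j hj => by simp [hj]
  have hset : {w : Winners k | winCoord w i v = a} =
      Function.eval (lineThrough i v) ⁻¹' {⟨Function.update v i a, hp⟩} := by
    ext w
    simp only [Set.mem_ofPred_eq, Set.mem_preimage, Function.eval, Set.mem_singleton_iff,
      Subtype.ext_iff, coe_winner]
    exact (Function.update_injective v i).eq_iff.symm
  rw [hset, measureReal_def, winnersLaw,
    (measurePreserving_eval _ _).measure_preimage (measurableSet_singleton _).nullMeasurableSet,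
    uniformOn_univ]
  simp [card_lineThrough]

theorem prob_winCoord_ne (hk : ∀ i, 2 ≤ k i) (i : Fin n) (v : Vertex k) (a : Fin (k i)) :
    (winnersLaw k).real {w | winCoord w i v ≠ a} = 1 - 1 / k i := by
  have := isProbabilityMeasure_winnersLaw hk
  have h := measureReal_compl (μ := winnersLaw k) (s := {w | winCoord w i v = a})
    (Set.toFinite _).measurableSet
  rw [prob_winCoord_eq hk, probReal_univ] at h
  exact h

theorem winCoord_update (w : Winners k) (i : Fin n) (v : Vertex k) (a : Fin (k i)) :
    winCoord w i (Function.update v i a) = winCoord w i v := by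
  have : lineThrough i (Function.update v i a) = lineThrough i v := by
    apply Subtype.ext
    ext x
    simp only [mem_lineThrough]
    exact forall₂_congr fun l hl => by rw [Function.update_of_ne hl]
  rw [winCoord, winCoord, this]

/-! ### Detours around an edge. -/

/-- The path from `y` to `update y i a` which first moves in the coordinate `j`, then in the
coordinate `i`, and then back in the coordinate `j`, is open. -/
def Detour (w : Winners k) (y : Vertex k) (i : Fin n) (a : Fin (k i)) (j : Fin n) : Prop :=
  ∃ b, b ≠ y j ∧ winCoord w j y = b ∧ winCoord w i (Function.update y j b) = a ∧
    winCoord w j (Function.update y i a) = y j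

/-- There is an open detour from `y` to `update y i a`. -/
def Linked (w : Winners k) (y : Vertex k) (i : Fin n) (a : Fin (k i)) : Prop :=
  ∃ j, j ≠ i ∧ Detour w y i a j

theorem Linked.canReach {w : Winners k} {y : Vertex k} {i : Fin n} {a : Fin (k i)}
    (h : Linked w y i a) (ha : a ≠ y i) :
    CanReach (winnerGraph w) y (Function.update y i a) := by
  obtain ⟨j, hj, b, hb, h1, h2, h3⟩ := h
  refine ((Relation.ReflTransGen.single (adj_update hb h1)).tail
    (adj_update (by simpa [hj.symm] using ha) h2)).tail ?_
  rw [Function.update_comm hj]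
  have := adj_update (by simpa using hb.symm) ((winCoord_update w j _ b).trans h3)
  rwa [Function.update_idem, show Function.update (Function.update y i a) j (y j) =
    Function.update y i a from by
      conv_rhs => rw [← Function.update_eq_self j (Function.update y i a)]
      simp [hj]] at this

/-- The lines which determine whether the detour in coordinate `j` is open. -/
def detourLines (y : Vertex k) (i : Fin n) (a : Fin (k i)) (j : Fin n) : Set (Line k) :=
  {l | l = lineThrough j y ∨ l = lineThrough j (Function.update y i a) ∨
    ∃ b, b ≠ y j ∧ l = lineThrough i (Function.update y j b)}

theorem dependsOn_detour (y : Vertex k) (i : Fin n) (a : Fin (k i)) (j : Fin n) :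
    DependsOn (fun w => w ∈ {w | Detour w y i a j}) (detourLines y i a j) := by
  intro w w' h
  simp only [Set.mem_ofPred_eq, Detour, winCoord, eq_iff_iff]
  refine exists_congr fun b => and_congr_right fun hb => ?_
  rw [h _ (Or.inl rfl), h _ (Or.inr (Or.inl rfl)), h _ (Or.inr (Or.inr ⟨b, hb, rfl⟩))]

/-- The only possible clash is between two lines in coordinate `i`; the condition `b ≠ y j` in
`Detour` excludes it, since the first line then leaves `y` in coordinate `j` and the second does
not. -/
theorem disjoint_detourLines (hk : ∀ i, 2 ≤ k i) (y : Vertex k) {i : Fin n} (a : Fin (k i))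
    {j j' : Fin n} (hj : j ≠ i) (hj' : j' ≠ i) (hjj : j ≠ j') :
    Disjoint (detourLines y i a j) (detourLines y i a j') := by
  rw [Set.disjoint_left]
  rintro l (rfl | rfl | ⟨b, hb, rfl⟩) (h | h | ⟨b', hb', h⟩)
  all_goals rw [lineThrough_eq_iff hk] at h
  · exact hjj h.1
  · exact hjj h.1
  · exact hj h.1
  · exact hjj h.1
  · exact hjj h.1
  · exact hj h.1
  · exact hj' h.1.symm
  · exact hj' h.1.symm
  · have := h.2 j hj
    simp only [Function.update_self, Function.update_of_ne hjj] at this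
    exact hb this

/-- The events for different `b` are disjoint and each involves three distinct lines, giving (k_j -
1)/(k_j² k_i) in total; then (k_j - 1)/k_j ≥ 1/2. -/
theorem prob_detour_ge (hk : ∀ i, 2 ≤ k i) {K : ℕ} (hK : ∀ i, k i ≤ K) (y : Vertex k)
    {i : Fin n} {a : Fin (k i)} (ha : a ≠ y i) {j : Fin n} (hj : j ≠ i) :
    1 / (2 * (K : ℝ) ^ 2) ≤ (winnersLaw k).real {w | Detour w y i a j} := by
  classical
  have := isProbabilityMeasure_winnersLaw hk
  set B : Finset (Fin (k j)) := Finset.univ.erase (y j)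
  let C : Fin (k j) → Set (Winners k) := fun b => {w | winCoord w j y = b} ∩
    ({w | winCoord w i (Function.update y j b) = a} ∩
      {w | winCoord w j (Function.update y i a) = y j})
  have hset : {w | Detour w y i a j} = ⋃ b ∈ B, C b := by
    ext w
    simp [Detour, B, C]
    tauto
  have hC : ∀ b ∈ B, (winnersLaw k).real (C b) = 1 / k j * (1 / k i * (1 / k j)) := by
    intro b hb
    dsimp only [C]
    rw [prob_inter_of_dependsOn hk ?_ (dependsOn_winCoord j y b)
      (dependsOn_inter (dependsOn_winCoord i _ a) (dependsOn_winCoord j _ (y j))),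
      prob_inter_of_dependsOn hk ?_ (dependsOn_winCoord i _ a)
      (dependsOn_winCoord j _ (y j)), prob_winCoord_eq hk, prob_winCoord_eq hk,
      prob_winCoord_eq hk]
    · rw [Set.disjoint_singleton, Ne, lineThrough_eq_iff hk]
      exact fun h => hj h.1.symm
    · rw [Set.disjoint_singleton_left]
      rintro (h | h)
      · rw [Set.mem_singleton_iff, lineThrough_eq_iff hk] at h
        exact hj h.1
      · rw [Set.mem_singleton_iff, lineThrough_eq_iff hk] at h
        have := h.2 i hj.symm
        rw [Function.update_self] at this
        exact ha this.symm
  rw [hset, measureReal_biUnion_finset, Finset.sum_congr rfl hC, Finset.sum_const, nsmul_eq_mul,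
    Finset.card_erase_of_mem (Finset.mem_univ _), Finset.card_univ, Fintype.card_fin,
    Nat.cast_sub (by have := hk j; omega)]
  · have h1 : (2 : ℝ) ≤ k j := by exact_mod_cast hk j
    have h2 : (2 : ℝ) ≤ k i := by exact_mod_cast hk i
    have h3 : (k j : ℝ) ≤ K := by exact_mod_cast hK j
    have h4 : (k i : ℝ) ≤ K := by exact_mod_cast hK i
    have h5 : ((k j : ℝ) - (1 : ℕ)) * (1 / k j * (1 / k i * (1 / k j))) =
        ((k j : ℝ) - 1) / k j * (1 / (k i * k j)) := by
      field_simp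
      simp
    rw [h5]
    have h6 : (1 : ℝ) / 2 ≤ ((k j : ℝ) - 1) / k j := by
      rw [div_le_div_iff₀ (by norm_num) (by linarith)]
      linarith
    have h7 : 1 / (K : ℝ) ^ 2 ≤ 1 / (k i * k j) := by
      apply one_div_le_one_div_of_le (by positivity)
      rw [pow_two]
      gcongr
    calc 1 / (2 * (K : ℝ) ^ 2) = 1 / 2 * (1 / (K : ℝ) ^ 2) := by ring
      _ ≤ _ := by gcongr
  · intro b _ b' _ hbb'
    rw [Function.onFun, Set.disjoint_left]
    rintro w ⟨h, -⟩ ⟨h', -⟩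
    exact hbb' (h.symm.trans h')
  · exact fun b _ => (Set.toFinite _).measurableSet

theorem prob_not_linked_le (hk : ∀ i, 2 ≤ k i) {K : ℕ} (hK : ∀ i, k i ≤ K) (y : Vertex k)
    {i : Fin n} {a : Fin (k i)} (ha : a ≠ y i) :
    (winnersLaw k).real {w | ¬ Linked w y i a} ≤
      Real.exp (-(((n : ℝ) - 1) / (2 * (K : ℝ) ^ 2))) := by
  classical
  have := isProbabilityMeasure_winnersLaw hk
  set s : Finset (Fin n) := Finset.univ.erase i
  have hset : {w | ¬ Linked w y i a} = ⋂ j ∈ s, {w | Detour w y i a j}ᶜ := by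
    ext w
    simp [Linked, s]
  rw [hset, prob_biInter_of_dependsOn hk s _ (detourLines y i a)
    (fun j _ => dependsOn_compl (dependsOn_detour y i a j))]
  · calc ∏ j ∈ s, (winnersLaw k).real {w | Detour w y i a j}ᶜ
        ≤ ∏ j ∈ s, Real.exp (-(1 / (2 * (K : ℝ) ^ 2))) := by
          refine Finset.prod_le_prod (fun j _ => measureReal_nonneg) fun j hj => ?_
          rw [measureReal_compl (Set.toFinite _).measurableSet, probReal_univ]
          have h1 := prob_detour_ge hk hK y ha (Finset.ne_of_mem_erase hj)
          have h2 := Real.add_one_le_exp (-(1 / (2 * (K : ℝ) ^ 2)))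
          linarith
      _ = _ := by
          have hn : 0 < n := i.pos
          rw [Finset.prod_const, ← Real.exp_nat_mul, Finset.card_erase_of_mem (Finset.mem_univ _),
            Finset.card_univ, Fintype.card_fin, Nat.cast_sub (by omega)]
          congr 1
          push_cast
          ring
  · intro j hj j' hj' hjj
    exact disjoint_detourLines hk y a (Finset.ne_of_mem_erase hj) (Finset.ne_of_mem_erase hj') hjj

end DirectedGrid

/-! ### Encoding grown sets by walks. -/

section Walks

variable {V M : Type*} [DecidableEq V]

/-- The set of points visited by the walk from `x` which makes the given moves. -/
def visited (act : M → V → V) : List M → V → Finset V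
  | [], x => {x}
  | m :: l, x => insert x (visited act l (act m x))

/-- When the walk is at `p`, an excursion to `q` and back costs two moves and adds only `q`. -/
theorem exists_visited_eq_insert (act : M → V → V) {p q : V} {m m' : M} (hm : act m p = q)
    (hm' : act m' q = p) (l : List M) (x : V) (hp : p ∈ visited act l x) :
    ∃ l' : List M, l'.length = l.length + 2 ∧
      visited act l' x = insert q (visited act l x) := by
  induction l generalizing x with
  | nil =>
    obtain rfl : p = x := by simpa [visited] using hp
    refine ⟨[m, m'], rfl, ?_⟩
    simp only [visited, hm, hm']
    ext z
    simp only [Finset.mem_insert, Finset.mem_singleton]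
    tauto
  | cons m₀ l ih =>
    rw [visited, Finset.mem_insert] at hp
    rcases hp with rfl | hp
    · refine ⟨m :: m' :: m₀ :: l, rfl, ?_⟩
      simp only [visited, hm, hm']
      ext z
      simp only [Finset.mem_insert]
      tauto
    · obtain ⟨l', hl', h⟩ := ih _ hp
      refine ⟨m₀ :: l', by simp [hl'], ?_⟩
      simp only [visited, h]
      exact Finset.insert_comm _ _ _

/-- A set which can be grown from a point by adding neighbours of its elements one at a time is
the set of points visited by a walk. -/
theorem exists_growth (act : M → V → V) (P : Finset V → Prop) (x : V) (h0 : P {x}) (m : ℕ)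
    (grow : ∀ S, P S → S.card ≤ m → ∃ p ∈ S, ∃ q, q ∉ S ∧
      (∃ a, act a p = q) ∧ (∃ a, act a q = p) ∧ P (insert q S)) :
    ∃ l : List M, l.length = 2 * m ∧ P (visited act l x) ∧ (visited act l x).card = m + 1 := by
  induction m with
  | zero => exact ⟨[], rfl, h0, rfl⟩
  | succ m ih =>
    obtain ⟨l, hl, hP, hc⟩ := ih fun S hS hS' => grow S hS (by omega)
    obtain ⟨p, hp, q, hq, ⟨a, ha⟩, ⟨b, hb⟩, hPq⟩ := grow _ hP (by omega)
    obtain ⟨l', hl', h⟩ := exists_visited_eq_insert act ha hb l x hp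
    refine ⟨l', by omega, h ▸ hPq, ?_⟩
    rw [h, Finset.card_insert_of_notMem hq, hc]

end Walks

/-! ### Good vertices, and walks through connected or separated sets. -/

namespace DirectedGrid

variable {n : ℕ} {k : Fin n → ℕ}

theorem hammingDist_update_le (x : Vertex k) (i : Fin n) (a : Fin (k i)) :
    hammingDist x (Function.update x i a) ≤ 1 := by
  unfold hammingDist
  refine (Finset.card_le_card (t := {i}) fun j hj => ?_).trans (by simp)
  by_contra h
  simp only [Finset.mem_singleton] at h
  simp [h] at hj

theorem hammingDist_update_lt {x y : Vertex k} {i : Fin n} (h : x i ≠ y i) :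
    hammingDist (Function.update x i (y i)) y < hammingDist x y := by
  unfold hammingDist
  refine Finset.card_lt_card ((Finset.ssubset_iff_of_subset fun j hj => ?_).2
    ⟨i, by simpa using h, by simp⟩)
  by_cases hji : j = i
  · subst hji; simp at hj
  · simpa [hji] using hj

theorem hammingDist_le_one_of_mem_line (l : Line k) {u v : Vertex k} (hu : u ∈ l.1)
    (hv : v ∈ l.1) : hammingDist u v ≤ 1 := by
  obtain ⟨i, rfl⟩ := exists_eq_lineThrough l hu
  have h := mem_lineThrough.1 hv
  have : v = Function.update u i (v i) := by
    ext j
    by_cases hj : j = i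
    · subst hj; simp
    · simp [hj, h j hj]
  rw [this]
  exact hammingDist_update_le u i _

/-- The lines which come within distance `r` of the vertex `x`. -/
def nearLines (x : Vertex k) (r : ℕ) : Set (Line k) := {l | ∃ v ∈ l.1, hammingDist x v ≤ r}

theorem disjoint_nearLines {x y : Vertex k} {r : ℕ} (h : 2 * r + 1 < hammingDist x y) :
    Disjoint (nearLines x r) (nearLines y r) := by
  rw [Set.disjoint_left]
  rintro l ⟨u, hu, hxu⟩ ⟨v, hv, hyv⟩
  have h1 := hammingDist_le_one_of_mem_line l hu hv
  have h2 := hammingDist_triangle x u v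
  have h3 := hammingDist_triangle_right x y v
  omega

theorem dependsOn_linked (y : Vertex k) (i : Fin n) (a : Fin (k i)) :
    DependsOn (fun w => w ∈ {w | Linked w y i a}) (nearLines y 1) := by
  intro w w' h
  simp only [Set.mem_ofPred_eq, Linked, eq_iff_iff]
  refine exists_congr fun j => and_congr_right fun hj => Iff.of_eq ?_
  refine dependsOn_detour y i a j fun l hl => h l ?_
  rcases hl with rfl | rfl | ⟨b, -, rfl⟩
  · exact ⟨y, self_mem_lineThrough _ _, by simp⟩
  · exact ⟨_, self_mem_lineThrough _ _, hammingDist_update_le _ _ _⟩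
  · exact ⟨_, self_mem_lineThrough _ _, hammingDist_update_le _ _ _⟩

/-- All edges of the Hamming graph starting near `x` can be replaced by open detours. -/
def Good (w : Winners k) (x : Vertex k) : Prop :=
  ∀ y, hammingDist x y ≤ 4 → ∀ i a, a ≠ y i → Linked w y i a

theorem dependsOn_good (x : Vertex k) :
    DependsOn (fun w => w ∈ {w | Good w x}) (nearLines x 5) := by
  intro w w' h
  simp only [Set.mem_ofPred_eq, Good, eq_iff_iff]
  refine forall₄_congr fun y hy i a => imp_congr_right fun _ => Iff.of_eq ?_
  refine dependsOn_linked y i a fun l hl => h l ?_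
  obtain ⟨v, hv, hyv⟩ := hl
  exact ⟨v, hv, (hammingDist_triangle x y v).trans (by omega)⟩

/-- Coordinates of `y` are corrected towards `x` one at a time. All intermediate vertices stay in
the ball of radius 4, so each edge has an open detour in both directions. -/
theorem Good.canReach {w : Winners k} {x y : Vertex k} (hx : Good w x)
    (hxy : hammingDist x y ≤ 4) :
    CanReach (winnerGraph w) x y ∧ CanReach (winnerGraph w) y x := by
  induction hm : hammingDist x y using Nat.strong_induction_on generalizing y with
  | _ m ih =>
    by_cases hyx : x = y
    · subst hyx
      exact ⟨Relation.ReflTransGen.refl, Relation.ReflTransGen.refl⟩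
    · obtain ⟨i, hi⟩ := Function.ne_iff.1 hyx
      have hlt : hammingDist x (Function.update y i (x i)) < m := by
        rw [← hm, hammingDist_comm x, hammingDist_comm x]
        exact hammingDist_update_lt hi.symm
      obtain ⟨h1, h2⟩ := ih _ hlt (by omega) rfl
      have h3 := (hx (Function.update y i (x i)) (by omega) i (y i)
        (by simpa using hi.symm)).canReach (by simpa using hi.symm)
      rw [Function.update_idem, Function.update_eq_self] at h3
      exact ⟨h1.trans h3, ((hx y hxy i (x i) hi).canReach hi).trans h2⟩

/-- A move changes one coordinate to a given value. -/
abbrev Move (k : Fin n → ℕ) : Type := (i : Fin n) × Fin (k i)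

/-- Make `r` moves in a row. -/
def jump {r : ℕ} (m : List.Vector (Move k) r) (x : Vertex k) : Vertex k :=
  m.1.foldl (fun v a => Function.update v a.1 a.2) x

/-- A move may leave the vertex unchanged, so a shorter sequence can be padded to length exactly
`r`; this needs some coordinate, hence `0 < n`. -/
theorem exists_jump_eq (hn : 0 < n) {r : ℕ} {x y : Vertex k} (h : hammingDist x y ≤ r) :
    ∃ m : List.Vector (Move k) r, jump m x = y := by
  induction r generalizing x with
  | zero => exact ⟨List.Vector.nil, hammingDist_eq_zero.1 (Nat.le_zero.1 h)⟩
  | succ r ih =>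
    by_cases hxy : x = y
    · subst hxy
      obtain ⟨m, hm⟩ := ih (x := x) (by simp)
      refine ⟨⟨⟨⟨0, hn⟩, x ⟨0, hn⟩⟩ :: m.1, by simp⟩, ?_⟩
      simpa [jump] using hm
    · obtain ⟨i, hi⟩ := Function.ne_iff.1 hxy
      obtain ⟨m, hm⟩ := ih (x := Function.update x i (y i))
        (by have := hammingDist_update_lt hi; omega)
      exact ⟨⟨⟨i, y i⟩ :: m.1, by simp⟩, by simpa [jump] using hm⟩

/-- Every element of `S` is joined to `u` by a path in the Hamming graph inside `S`. -/
def ConnectedFrom (S : Set (Vertex k)) (u : Vertex k) : Prop :=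
  ∀ z ∈ S, Relation.ReflTransGen (fun a b => b ∈ S ∧ hammingDist a b ≤ 1) u z

theorem hammingDist_le_one_of_adj {w : Winners k} {u v : Vertex k}
    (h : (winnerGraph w).Adj u v) : hammingDist u v ≤ 1 := by
  obtain ⟨-, l, hu, hv, -⟩ := h
  exact hammingDist_le_one_of_mem_line l hu hv

theorem connectedFrom_descendants (w : Winners k) (u : Vertex k) :
    ConnectedFrom {z | CanReach (winnerGraph w) u z} u := by
  intro z hz
  induction hz with
  | refl => exact Relation.ReflTransGen.refl
  | tail hb hbc ih => exact ih.tail ⟨hb.tail hbc, hammingDist_le_one_of_adj hbc⟩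

theorem connectedFrom_ancestors (w : Winners k) (v : Vertex k) :
    ConnectedFrom {z | CanReach (winnerGraph w) z v} v := by
  intro z hz
  induction hz using Relation.ReflTransGen.head_induction_on with
  | refl => exact Relation.ReflTransGen.refl
  | head hb hbc ih =>
    refine ih.tail ⟨hbc.head hb, ?_⟩
    rw [hammingDist_comm]
    exact hammingDist_le_one_of_adj hb

/-- A connected set of vertices is the set of points visited by a short walk. -/
theorem ConnectedFrom.exists_visited_eq (hn : 0 < n) {S : Finset (Vertex k)} {u : Vertex k}
    (hS : ConnectedFrom (S : Set (Vertex k)) u) (hu : u ∈ S) :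
    ∃ l : List (List.Vector (Move k) 1), l.length = 2 * (S.card - 1) ∧ visited jump l u = S := by
  have hpos : 0 < S.card := Finset.card_pos.2 ⟨u, hu⟩
  -- A path inside `S` from `u` to a point outside `S'` has a first step leaving `S'`; its endpoint
  -- is added.
  obtain ⟨l, hl, ⟨h1, -⟩, hc⟩ := exists_growth (jump (k := k) (r := 1))
    (fun S' => S' ⊆ S ∧ u ∈ S') u (by simpa using hu) (S.card - 1) (by
      rintro S' ⟨h1, h2⟩ hc
      obtain ⟨z, hz, hz'⟩ := Finset.exists_of_ssubset (Finset.ssubset_iff_subset_ne.2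
        ⟨h1, by rintro rfl; omega⟩)
      have key : z ∈ S' ∨ ∃ p ∈ S', ∃ q, q ∉ S' ∧ q ∈ S ∧ hammingDist p q ≤ 1 := by
        have hpath := hS z hz
        clear hz' hz
        induction hpath with
        | refl => exact Or.inl h2
        | @tail b c _ hbc ih =>
          refine ih.elim (fun hb => ?_) Or.inr
          by_cases hc : c ∈ S'
          · exact Or.inl hc
          · exact Or.inr ⟨b, hb, c, hc, hbc.1, hbc.2⟩
      obtain ⟨p, hp, q, hq, hqS, hpq⟩ := key.resolve_left hz'
      exact ⟨p, hp, q, hq, exists_jump_eq hn hpq, exists_jump_eq hn (by rwa [hammingDist_comm]),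
        Finset.insert_subset hqS h1, Finset.mem_insert_of_mem h2⟩)
  exact ⟨l, hl, Finset.eq_of_subset_of_card_le h1 (by omega)⟩

/-- A connected set which contains a point far away from its origin contains a large separated
set, which is visited by a short walk with bounded jumps. -/
theorem ConnectedFrom.exists_separated (hn : 0 < n) {S : Set (Vertex k)} {u : Vertex k}
    (hS : ConnectedFrom S u) (hu : u ∈ S) {d T : ℕ} {z : Vertex k} (hz : z ∈ S)
    (hd : d * T ≤ hammingDist u z) (hd0 : 0 < d) :
    ∃ l : List (List.Vector (Move k) d), l.length = 2 * T ∧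
      (visited jump l u : Set (Vertex k)) ⊆ S ∧ (visited jump l u).card = T + 1 ∧
      (visited jump l u : Set (Vertex k)).Pairwise fun x y => d ≤ hammingDist x y := by
  rcases Nat.eq_zero_or_pos T with rfl | hT
  · exact ⟨[], rfl, by simpa [visited] using hu, rfl, by simp [visited]⟩
  -- Greedy growth. The last invariant keeps `S'` within distance d(|S'| - 1) of `u`, so `z` remains
  -- at distance at least `d` from `S'` while |S'| ≤ T.
  obtain ⟨l, hl, ⟨h1, h2, -⟩, hc⟩ := exists_growth (jump (k := k) (r := d))
    (fun S' => (S' : Set (Vertex k)) ⊆ S ∧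
      (S' : Set (Vertex k)).Pairwise (fun x y => d ≤ hammingDist x y) ∧ u ∈ S' ∧
      ∀ x ∈ S', hammingDist u x + d ≤ d * S'.card) u (by simpa using hu) T (by
      rintro S' ⟨h1, h2, h3, h4⟩ hc
      -- Along a path to `z`, the first point at distance at least `d` from all of `S'` is at
      -- distance at most `d` from some point of it, as steps have length at most 1.
      have key : (∃ x ∈ S', hammingDist x z < d) ∨
          ∃ q ∈ S, (∀ x ∈ S', d ≤ hammingDist x q) ∧ ∃ p ∈ S', hammingDist p q ≤ d := by
        have hpath := hS z hz
        clear hd hz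
        induction hpath with
        | refl => exact Or.inl ⟨u, h3, by simpa using hd0⟩
        | @tail b c _ hbc ih =>
          refine ih.elim (fun ⟨x, hx, hxb⟩ => ?_) Or.inr
          by_cases hc : ∃ x ∈ S', hammingDist x c < d
          · exact Or.inl hc
          · push Not at hc
            refine Or.inr ⟨c, hbc.1, hc, x, hx, ?_⟩
            have := hammingDist_triangle x b c
            omega
      have hnot : ¬ ∃ x ∈ S', hammingDist x z < d := by
        rintro ⟨x, hx, hxz⟩
        have e1 := h4 x hx
        have e2 := hammingDist_triangle u x z
        have e3 : d * S'.card ≤ d * T := Nat.mul_le_mul_left d hc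
        omega
      obtain ⟨q, hqS, hq, p, hp, hpq⟩ := key.resolve_left hnot
      have hqS' : q ∉ S' := fun h => by
        have := hq q h
        simp at this
        omega
      refine ⟨p, hp, q, hqS', exists_jump_eq hn hpq,
        exists_jump_eq hn (by rwa [hammingDist_comm]), ?_, ?_, Finset.mem_insert_of_mem h3, ?_⟩
      · rw [Finset.coe_insert]
        exact Set.insert_subset hqS h1
      · rw [Finset.coe_insert]
        refine h2.insert fun x hx _ => ⟨?_, hq x hx⟩
        rw [hammingDist_comm]
        exact hq x hx
      · rw [Finset.card_insert_of_notMem hqS', Nat.mul_add, Nat.mul_one]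
        have hle : hammingDist u q ≤ d * S'.card := by
          have e1 := h4 p hp
          have e2 := hammingDist_triangle u p q
          omega
        intro x hx
        rcases Finset.mem_insert.1 hx with rfl | hx
        · omega
        · have := h4 x hx
          omega)
  exact ⟨l, hl, h1, hc, h2⟩

theorem prob_mono (hk : ∀ i, 2 ≤ k i) {E F : Set (Winners k)} (h : E ⊆ F) :
    (winnersLaw k).real E ≤ (winnersLaw k).real F := by
  have := isProbabilityMeasure_winnersLaw hk
  exact measureReal_mono h

theorem prob_exists_le (hk : ∀ i, 2 ≤ k i) {A : Type*} [Fintype A] (p : A → Winners k → Prop)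
    {c : ℝ} (h : ∀ a, (winnersLaw k).real {w | p a w} ≤ c) :
    (winnersLaw k).real {w | ∃ a, p a w} ≤ Fintype.card A * c := by
  have := isProbabilityMeasure_winnersLaw hk
  have hset : {w | ∃ a, p a w} = ⋃ a, {w | p a w} := by ext w; simp
  rw [hset]
  refine (measureReal_iUnion_fintype_le _).trans ?_
  refine (Finset.sum_le_sum fun a _ => h a).trans ?_
  simp

theorem prob_not_good_le (hk : ∀ i, 2 ≤ k i) {q : ℝ} (hq0 : 0 ≤ q)
    (hq : ∀ (y : Vertex k) i a, a ≠ y i → (winnersLaw k).real {w | ¬ Linked w y i a} ≤ q)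
    (hn : 0 < n) (x : Vertex k) :
    (winnersLaw k).real {w | ¬ Good w x} ≤ (Fintype.card (Move k) : ℝ) ^ 5 * q := by
  have h := prob_exists_le hk (A := List.Vector (Move k) 4 × Move k)
    (fun m w => m.2.2 ≠ (jump m.1 x) m.2.1 ∧ ¬ Linked w (jump m.1 x) m.2.1 m.2.2) (c := q) (by
      rintro ⟨m, i, a⟩
      by_cases ha : a ≠ jump m x i
      · simpa [ha] using hq (jump m x) i a ha
      · simpa [ha] using hq0)
  rw [Fintype.card_prod, card_vector] at h
  calc _ ≤ _ := prob_mono hk ?_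
    _ ≤ _ := h
    _ = _ := by push_cast; ring
  intro w hw
  simp only [Good, Set.mem_ofPred_eq] at hw ⊢
  push Not at hw
  obtain ⟨y, hy, i, a, ha, hl⟩ := hw
  obtain ⟨m, rfl⟩ := exists_jump_eq hn hy
  exact ⟨(m, ⟨i, a⟩), ha, hl⟩

/-- Goodness depends on lines within distance 5 (radius 4 plus one step of a detour), and such
neighbourhoods are disjoint once 2 · 5 + 1 < 12. -/
theorem prob_forall_not_good_le (hk : ∀ i, 2 ≤ k i) {p : ℝ}
    (hp : ∀ x : Vertex k, (winnersLaw k).real {w | ¬ Good w x} ≤ p) (S : Finset (Vertex k))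
    (hS : (S : Set (Vertex k)).Pairwise fun x y => 12 ≤ hammingDist x y) :
    (winnersLaw k).real {w | ∀ x ∈ S, ¬ Good w x} ≤ p ^ S.card := by
  have hset : {w | ∀ x ∈ S, ¬ Good w x} = ⋂ x ∈ S, {w | Good w x}ᶜ := by ext w; simp
  rw [hset, prob_biInter_of_dependsOn hk S _ (fun x => nearLines x 5)
    fun x _ => dependsOn_compl (dependsOn_good x)]
  · exact (Finset.prod_le_prod (fun _ _ => measureReal_nonneg) fun x _ => hp x).trans (by simp)
  · intro x hx y hy hxy
    exact disjoint_nearLines (lt_of_lt_of_le (by norm_num) (hS hx hy hxy))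

/-- It is unlikely that there is a large separated set of vertices which are not good. -/
theorem prob_exists_not_good_le (hk : ∀ i, 2 ≤ k i) {p : ℝ} (hp0 : 0 ≤ p)
    (hp : ∀ x : Vertex k, (winnersLaw k).real {w | ¬ Good w x} ≤ p) (T : ℕ) :
    (winnersLaw k).real {w | ∃ (u : Vertex k) (l : List (List.Vector (Move k) 12)),
      l.length = 2 * T ∧ (visited jump l u).card = T + 1 ∧
      ((visited jump l u : Set (Vertex k)).Pairwise fun x y => 12 ≤ hammingDist x y) ∧
      ∀ x ∈ visited jump l u, ¬ Good w x} ≤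
      Fintype.card (Vertex k) * (((Fintype.card (Move k) : ℝ) ^ 24) ^ T * p ^ (T + 1)) := by
  have h := prob_exists_le hk
    (A := Vertex k × List.Vector (List.Vector (Move k) 12) (2 * T))
    (fun m w => (visited jump m.2.1 m.1).card = T + 1 ∧
      ((visited jump m.2.1 m.1 : Set (Vertex k)).Pairwise fun x y => 12 ≤ hammingDist x y) ∧
      ∀ x ∈ visited jump m.2.1 m.1, ¬ Good w x) (c := p ^ (T + 1)) (by
      rintro ⟨u, l⟩
      by_cases h1 : (visited jump l.1 u).card = T + 1
      · by_cases h2 : (visited jump l.1 u : Set (Vertex k)).Pairwise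
            fun x y => 12 ≤ hammingDist x y
        · have := prob_forall_not_good_le hk hp _ h2
          simpa [h1, h2] using this
        · simpa [h2] using by positivity
      · simpa [h1] using by positivity)
  rw [Fintype.card_prod, card_vector, card_vector] at h
  calc _ ≤ _ := prob_mono hk ?_
    _ ≤ _ := h
    _ = _ := by push_cast; ring
  rintro w ⟨u, l, hl, h1⟩
  exact ⟨(u, ⟨l, hl⟩), h1⟩

/-! ### Independent routes between two good vertices. -/

/-- The vertex which agrees with `y` in the first `t` coordinates and with `x` in the others,
except that its `j`th block of four coordinates is taken from `c`. -/
def route (x y c : Vertex k) (j t : ℕ) : Vertex k :=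
  fun i => if i.1 / 4 = j then c i else if i.1 < t then y i else x i

theorem exists_avoiding (hk : ∀ i, 2 ≤ k i) (x y : Vertex k) :
    ∃ c : Vertex k, ∀ i : Fin n, (i.1 % 2 = 0 → c i ≠ y i) ∧ (i.1 % 2 = 1 → c i ≠ x i) := by
  have (i : Fin n) : ∃ c : Fin (k i), (i.1 % 2 = 0 → c ≠ y i) ∧ (i.1 % 2 = 1 → c ≠ x i) := by
    have : Nontrivial (Fin (k i)) := Fin.nontrivial_iff_two_le.2 (hk i)
    rcases Nat.mod_two_eq_zero_or_one i.1 with h | h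
    · obtain ⟨c, hc⟩ := exists_ne (y i)
      exact ⟨c, fun _ => hc, by omega⟩
    · obtain ⟨c, hc⟩ := exists_ne (x i)
      exact ⟨c, by omega, fun _ => hc⟩
  choose c hc using this
  exact ⟨c, hc⟩

/-- Blocks `j` and `j'` consist of two pairs of coordinates each, and every pair contributes a
difference. Distance 4 exceeds 2 · 1 + 1, so detours along different routes use disjoint sets of
lines. -/
theorem hammingDist_route_ge {x y c : Vertex k}
    (hc : ∀ i : Fin n, (i.1 % 2 = 0 → c i ≠ y i) ∧ (i.1 % 2 = 1 → c i ≠ x i))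
    {j j' : ℕ} (hj : 4 * j + 3 < n) (hj' : 4 * j' + 3 < n) (hjj : j ≠ j') (t t' : ℕ) :
    4 ≤ hammingDist (route x y c j t) (route x y c j' t') := by
  classical
  have key : ∀ {j j' t t' : ℕ}, j ≠ j' → ∀ l, l / 2 = j → 2 * l + 1 < n →
      ∃ i : Fin n, i.1 / 2 = l ∧ route x y c j t i ≠ route x y c j' t' i := by
    intro j j' t t' hjj l hl hln
    -- Outside its own block, the other route shows `y` at 2l or `x` at 2l + 1, depending on `t'`;
    -- `c` avoids `y` at even and `x` at odd positions.
    by_cases h : 2 * l < t'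
    · refine ⟨⟨2 * l, by omega⟩, by simp, ?_⟩
      have e1 : 2 * l / 4 = j := by omega
      simp only [route, e1, if_true, if_neg hjj, if_pos h]
      exact (hc _).1 (by simp)
    · refine ⟨⟨2 * l + 1, hln⟩, by dsimp only; omega, ?_⟩
      have e1 : (2 * l + 1) / 4 = j := by omega
      have e2 : ¬ 2 * l + 1 < t' := by omega
      simp only [route, e1, if_true, if_neg hjj, if_neg e2]
      exact (hc _).2 (by simp)
  have key' : ∀ {j j' t t' : ℕ}, j ≠ j' → 4 * j + 3 < n →
      ∀ l, l / 2 = j → ∃ i : Fin n, i.1 / 2 = l ∧ route x y c j t i ≠ route x y c j' t' i :=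
    fun h h' l hl => key h l hl (by omega)
  have hsub : ({2 * j, 2 * j + 1, 2 * j', 2 * j' + 1} : Finset ℕ) ⊆
      (Finset.univ.filter fun i => route x y c j t i ≠ route x y c j' t' i).image
        fun i : Fin n => i.1 / 2 := by
    intro l hl
    simp only [Finset.mem_image, Finset.mem_filter, Finset.mem_univ, true_and]
    have : l / 2 = j ∨ l / 2 = j' := by
      simp only [Finset.mem_insert, Finset.mem_singleton] at hl
      omega
    rcases this with h | h
    · obtain ⟨i, hi, h'⟩ := key' (t := t) (t' := t') hjj hj l h
      exact ⟨i, h', hi⟩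
    · obtain ⟨i, hi, h'⟩ := key' (t := t') (t' := t) hjj.symm hj' l h
      exact ⟨i, h'.symm, hi⟩
  have hcard : ({2 * j, 2 * j + 1, 2 * j', 2 * j' + 1} : Finset ℕ).card = 4 := by
    rw [Finset.card_insert_of_notMem, Finset.card_insert_of_notMem, Finset.card_pair]
    all_goals simp
    all_goals omega
  rw [← hcard]
  exact (Finset.card_le_card hsub).trans Finset.card_image_le

theorem card_block_le (j : ℕ) : (Finset.univ.filter fun i : Fin n => i.1 / 4 = j).card ≤ 4 := by
  classical
  rw [← Finset.card_image_of_injective _ Fin.val_injective]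
  refine (Finset.card_le_card (t := Finset.Ico (4 * j) (4 * j + 4)) fun l hl => ?_).trans
    (by simp)
  simp only [Finset.mem_image, Finset.mem_filter, Finset.mem_univ, true_and] at hl
  obtain ⟨i, hi, rfl⟩ := hl
  rw [Finset.mem_Ico]
  omega

theorem hammingDist_route_zero_le (x y c : Vertex k) (j : ℕ) :
    hammingDist x (route x y c j 0) ≤ 4 := by
  refine (Finset.card_le_card fun i hi => ?_).trans (card_block_le (n := n) j)
  simp only [Finset.mem_filter, Finset.mem_univ, true_and] at hi ⊢
  by_contra h
  simp [route, h] at hi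

theorem hammingDist_route_last_le (x y c : Vertex k) (j : ℕ) :
    hammingDist y (route x y c j n) ≤ 4 := by
  refine (Finset.card_le_card fun i hi => ?_).trans (card_block_le (n := n) j)
  simp only [Finset.mem_filter, Finset.mem_univ, true_and] at hi ⊢
  by_contra h
  simp [route, h] at hi

theorem update_route (x y c : Vertex k) (j : ℕ) (t : Fin n) :
    Function.update (route x y c j t) t (route x y c j (t + 1) t) = route x y c j (t + 1) := by
  ext i
  by_cases hi : i = t
  · subst hi; simp
  · have : i.1 ≠ t.1 := fun h => hi (Fin.ext h)
    have h2 : i.1 < t.1 ↔ i.1 < t.1 + 1 := by omega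
    simp only [route, Function.update_of_ne hi, h2]

/-- Some step of the `j`th route from `x` to `y` cannot be replaced by an open detour. -/
def Blocked (w : Winners k) (x y c : Vertex k) (j : ℕ) : Prop :=
  ∃ t : Fin n, route x y c j (t + 1) t ≠ route x y c j t t ∧
    ¬ Linked w (route x y c j t) t (route x y c j (t + 1) t)

theorem dependsOn_blocked (x y c : Vertex k) (j : ℕ) :
    DependsOn (fun w => w ∈ {w | Blocked w x y c j})
      (⋃ t : Fin n, nearLines (route x y c j t) 1) := by
  intro w w' h
  simp only [Set.mem_ofPred_eq, Blocked, eq_iff_iff]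
  refine exists_congr fun t => and_congr_right fun _ => not_congr (Iff.of_eq ?_)
  exact dependsOn_linked _ _ _ fun l hl => h l (Set.mem_iUnion.2 ⟨t, hl⟩)

theorem prob_forall_blocked_le (hk : ∀ i, 2 ≤ k i) {q : ℝ} (hq0 : 0 ≤ q)
    (hq : ∀ (y : Vertex k) i a, a ≠ y i → (winnersLaw k).real {w | ¬ Linked w y i a} ≤ q)
    {x y c : Vertex k}
    (hc : ∀ i : Fin n, (i.1 % 2 = 0 → c i ≠ y i) ∧ (i.1 % 2 = 1 → c i ≠ x i)) :
    (winnersLaw k).real {w | ∀ j < n / 4, Blocked w x y c j} ≤ (n * q) ^ (n / 4) := by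
  have hset : {w | ∀ j < n / 4, Blocked w x y c j} =
      ⋂ j ∈ Finset.range (n / 4), {w | Blocked w x y c j} := by ext w; simp
  rw [hset, prob_biInter_of_dependsOn hk _ _ (fun j => ⋃ t : Fin n, nearLines (route x y c j t) 1)
    fun j _ => dependsOn_blocked x y c j]
  · refine (Finset.prod_le_prod (g := fun _ => n * q) (fun _ _ => measureReal_nonneg)
      fun j _ => ?_).trans (by simp)
    have h := prob_exists_le hk (A := Fin n) (fun t w =>
      route x y c j (t + 1) t ≠ route x y c j t t ∧
      ¬ Linked w (route x y c j t) t (route x y c j (t + 1) t)) (c := q) (by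
        intro t
        by_cases ht : route x y c j (t + 1) t ≠ route x y c j t t
        · simpa [ht] using hq _ t _ ht
        · simpa [ht] using hq0)
    rw [Fintype.card_fin] at h
    exact h
  · intro j hj j' hj' hjj
    simp only [Finset.coe_range, Set.mem_Iio] at hj hj'
    rw [Function.onFun, Set.disjoint_iUnion_left]
    intro t
    rw [Set.disjoint_iUnion_right]
    intro t'
    exact disjoint_nearLines (lt_of_lt_of_le (by norm_num)
      (hammingDist_route_ge hc (by omega) (by omega) hjj t t'))

theorem Good.canReach_of_not_blocked {w : Winners k} {x y c : Vertex k} (hx : Good w x)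
    (hy : Good w y) {j : ℕ} (h : ¬ Blocked w x y c j) : CanReach (winnerGraph w) x y := by
  have hroute : ∀ t ≤ n, CanReach (winnerGraph w) x (route x y c j t) := by
    intro t
    induction t with
    | zero => exact fun _ => (hx.canReach (hammingDist_route_zero_le x y c j)).1
    | succ t ih =>
      intro ht
      refine (ih (by omega)).trans ?_
      rw [← update_route x y c j ⟨t, ht⟩]
      by_cases hne : route x y c j (t + 1) ⟨t, ht⟩ = route x y c j t ⟨t, ht⟩
      · simp only [hne, Function.update_eq_self]
        exact Relation.ReflTransGen.refl
      · refine Linked.canReach ?_ hne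
        by_contra hl
        exact h ⟨⟨t, ht⟩, hne, hl⟩
  exact (hroute n le_rfl).trans (hy.canReach (hammingDist_route_last_le x y c j)).2

/-- It is unlikely that there are good vertices which cannot reach each other. -/
theorem prob_exists_good_not_canReach_le (hk : ∀ i, 2 ≤ k i) {q : ℝ} (hq0 : 0 ≤ q)
    (hq : ∀ (y : Vertex k) i a, a ≠ y i → (winnersLaw k).real {w | ¬ Linked w y i a} ≤ q) :
    (winnersLaw k).real {w | ∃ x y, Good w x ∧ Good w y ∧ ¬ CanReach (winnerGraph w) x y} ≤
      (Fintype.card (Vertex k) : ℝ) ^ 2 * (n * q) ^ (n / 4) := by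
  have h := prob_exists_le hk (A := Vertex k × Vertex k)
    (fun m w => Good w m.1 ∧ Good w m.2 ∧ ¬ CanReach (winnerGraph w) m.1 m.2)
    (c := (n * q) ^ (n / 4)) (by
      rintro ⟨x, y⟩
      obtain ⟨c, hc⟩ := exists_avoiding hk x y
      refine (prob_mono hk ?_).trans (prob_forall_blocked_le hk hq0 hq hc)
      rintro w ⟨hx, hy, hxy⟩ j -
      by_contra hj
      exact hxy (hx.canReach_of_not_blocked hy hj))
  rw [Fintype.card_prod] at h
  calc _ ≤ _ := prob_mono hk ?_
    _ ≤ _ := h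
    _ = _ := by push_cast; ring
  rintro w ⟨x, y, h1⟩
  exact ⟨(x, y), h1⟩

/-! ### Lines meeting a set once, and the union bound over closed connected sets. -/

open Classical in
/-- The pairs of a vertex `x` of `S` and a coordinate `i` such that the line in coordinate `i`
through `x` meets `S` only in `x`. -/
noncomputable def singles (S : Finset (Vertex k)) : Finset (Vertex k × Fin n) :=
  (S ×ˢ Finset.univ).filter fun p => ∀ y ∈ S, y ∈ (lineThrough p.2 p.1).1 → y = p.1

theorem mem_singles {S : Finset (Vertex k)} {p : Vertex k × Fin n} :
    p ∈ singles S ↔ p.1 ∈ S ∧ ∀ y ∈ S, y ∈ (lineThrough p.2 p.1).1 → y = p.1 := by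
  simp [singles]

/-- Among two points of `S` on a common line in coordinate i, at most one agrees with `u` there. A
non-single pair is thus either counted by the distance to `u`, or is the image of a counted pair on
the same line under resetting coordinate i to that of `u`. -/
theorem card_not_single_le (S : Finset (Vertex k)) (u : Vertex k) :
    ((S ×ˢ Finset.univ) \ singles S).card ≤ 2 * ∑ x ∈ S, hammingDist u x := by
  classical
  set A : Finset (Vertex k × Fin n) := (S ×ˢ Finset.univ).filter fun p => u p.2 ≠ p.1 p.2
  have hA : A.card = ∑ x ∈ S, hammingDist u x := by
    rw [Finset.card_filter, Finset.sum_product]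
    refine Finset.sum_congr rfl fun x _ => ?_
    rw [hammingDist, Finset.card_filter]
  have hsub : (S ×ˢ Finset.univ) \ singles S ⊆
      A ∪ A.image fun p => (Function.update p.1 p.2 (u p.2), p.2) := by
    rintro ⟨x, i⟩ hp
    simp only [Finset.mem_sdiff, Finset.mem_product, Finset.mem_univ, and_true, mem_singles,
      not_and] at hp
    obtain ⟨hx, hp⟩ := hp
    have hp := hp hx
    push Not at hp
    obtain ⟨y, hy, hyx, hne⟩ := hp
    have hyx := mem_lineThrough.1 hyx
    rw [Finset.mem_union]
    by_cases hxi : u i = x i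
    · right
      refine Finset.mem_image.2 ⟨(y, i), ?_, ?_⟩
      · simp only [A, Finset.mem_filter, Finset.mem_product, Finset.mem_univ, and_true]
        refine ⟨hy, fun hui => hne ?_⟩
        ext j
        by_cases hj : j = i
        · subst hj; rw [← hui, hxi]
        · rw [hyx j hj]
      · refine Prod.ext ?_ rfl
        ext j
        by_cases hj : j = i
        · subst hj; simp [hxi]
        · simp [hj, hyx j hj]
    · left
      simp [A, hx, hxi]
  calc _ ≤ _ := Finset.card_le_card hsub
    _ ≤ A.card + A.card := (Finset.card_union_le _ _).trans
        (Nat.add_le_add_left Finset.card_image_le _)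
    _ = _ := by rw [hA]; ring

/-- Most pairs are single if `S` is contained in a small ball. -/
theorem sum_singles_ge {S : Finset (Vertex k)} {u : Vertex k} {R B : ℝ}
    (hR : ∀ x ∈ S, (hammingDist u x : ℝ) ≤ R) (f : Fin n → ℝ) (hB : 0 ≤ B) (hf : ∀ i, f i ≤ B) :
    S.card * (∑ i, f i - 2 * R * B) ≤ ∑ p ∈ singles S, f p.2 := by
  classical
  have h1 : ∑ p ∈ S ×ˢ Finset.univ, f p.2 = S.card * ∑ i, f i := by
    simp [Finset.sum_product]
  have hsub : singles S ⊆ S ×ˢ Finset.univ := Finset.filter_subset _ _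
  have h2 := Finset.sum_sdiff (f := fun p : Vertex k × Fin n => f p.2) hsub
  have h3 : ∑ p ∈ (S ×ˢ Finset.univ) \ singles S, f p.2 ≤
      ((S ×ˢ Finset.univ) \ singles S).card * B := by
    rw [← nsmul_eq_mul]
    exact Finset.sum_le_card_nsmul _ _ _ fun p _ => hf p.2
  have h4 : (((S ×ˢ Finset.univ) \ singles S).card : ℝ) ≤ 2 * (S.card * R) := by
    refine (Nat.cast_le.2 (card_not_single_le S u)).trans ?_
    push_cast
    gcongr
    rw [← nsmul_eq_mul]
    exact Finset.sum_le_card_nsmul _ _ _ hR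
  have h5 := mul_le_mul_of_nonneg_right h4 hB
  rw [← h2] at h1
  linarith

theorem pairwiseDisjoint_singles (hk : ∀ i, 2 ≤ k i) (S : Finset (Vertex k)) :
    (singles S : Set (Vertex k × Fin n)).PairwiseDisjoint
      fun p => ({lineThrough p.2 p.1} : Set (Line k)) := by
  rintro ⟨x, i⟩ hx ⟨y, j⟩ hy hne
  rw [Function.onFun, Set.disjoint_singleton]
  intro h
  rw [Finset.mem_coe, mem_singles] at hx hy
  refine hne (Prod.ext (hx.2 y hy.1 ?_).symm ((lineThrough_eq_iff hk).1 h).1)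
  rw [h]
  exact self_mem_lineThrough j y

/-- All lines which meet `S` once are won inside `S`. -/
def OutClosed (S : Finset (Vertex k)) (w : Winners k) : Prop :=
  ∀ p ∈ singles S, winCoord w p.2 p.1 = p.1 p.2

/-- All lines which meet `S` once are won outside `S`. -/
def InClosed (S : Finset (Vertex k)) (w : Winners k) : Prop :=
  ∀ p ∈ singles S, winCoord w p.2 p.1 ≠ p.1 p.2

theorem prob_outClosed_le (hk : ∀ i, 2 ≤ k i) (S : Finset (Vertex k)) :
    (winnersLaw k).real {w | OutClosed S w} ≤
      Real.exp (-∑ p ∈ singles S, Real.log (k p.2)) := by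
  have hset : {w | OutClosed S w} =
      ⋂ p ∈ singles S, {w | winCoord w p.2 p.1 = p.1 p.2} := by ext w; simp [OutClosed]
  rw [hset, prob_biInter_of_dependsOn hk _ _ (fun p => {lineThrough p.2 p.1})
    (fun p _ => dependsOn_winCoord p.2 p.1 (p.1 p.2)) (pairwiseDisjoint_singles hk S),
    ← Finset.sum_neg_distrib, Real.exp_sum]
  refine Finset.prod_le_prod (fun _ _ => measureReal_nonneg) fun p _ => ?_
  have h1 : (0 : ℝ) < k p.2 := by have := hk p.2; positivity
  rw [prob_winCoord_eq hk, Real.exp_neg, Real.exp_log h1, one_div]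

theorem prob_inClosed_le (hk : ∀ i, 2 ≤ k i) {K : ℕ} (hK : ∀ i, k i ≤ K)
    (S : Finset (Vertex k)) :
    (winnersLaw k).real {w | InClosed S w} ≤
      Real.exp (-((∑ p ∈ singles S, Real.log (k p.2)) / (K * Real.log K))) := by
  have hset : {w | InClosed S w} =
      ⋂ p ∈ singles S, {w | winCoord w p.2 p.1 = p.1 p.2}ᶜ := by ext w; simp [InClosed]
  rw [hset, prob_biInter_of_dependsOn hk _ _ (fun p => {lineThrough p.2 p.1})
    (fun p _ => dependsOn_compl (dependsOn_winCoord p.2 p.1 (p.1 p.2)))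
    (pairwiseDisjoint_singles hk S), Finset.sum_div, ← Finset.sum_neg_distrib, Real.exp_sum]
  refine Finset.prod_le_prod (fun _ _ => measureReal_nonneg) fun p _ => ?_
  refine (prob_winCoord_ne hk p.2 p.1 (p.1 p.2)).trans_le ?_
  have h1 : (2 : ℝ) ≤ k p.2 := by exact_mod_cast hk p.2
  have h2 : (k p.2 : ℝ) ≤ K := by exact_mod_cast hK p.2
  have h3 : 0 < Real.log K := Real.log_pos (by linarith)
  -- Weakening 1/k to log k/(K log K) expresses the bound through the sum of logarithms, whatever
  -- the individual sizes of the k_i.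
  have h4 : Real.log (k p.2) / (K * Real.log K) ≤ 1 / k p.2 := by
    rw [div_le_div_iff₀ (mul_pos (by linarith) h3) (by linarith), one_mul, mul_comm]
    exact mul_le_mul h2 (Real.log_le_log (by linarith) h2) (Real.log_nonneg (by linarith))
      (by linarith)
  have h5 := Real.add_one_le_exp (-(Real.log (k p.2) / (K * Real.log K)))
  linarith

/-- A union bound over all connected sets which contain at least `m` vertices. -/
theorem prob_exists_connected_le (hk : ∀ i, 2 ≤ k i) (hn : 0 < n)
    (Ev : Finset (Vertex k) → Winners k → Prop) {R a b : ℝ} (hb : 1 ≤ b)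
    (hEv : ∀ (u : Vertex k) S, (∀ x ∈ S, (hammingDist u x : ℝ) ≤ R) →
      (winnersLaw k).real {w | Ev S w} ≤ Real.exp (-(S.card * a)))
    (hab : (Fintype.card (Move k) : ℝ) ^ 2 * Real.exp (-a) ≤ Real.exp (-b)) (m : ℕ) :
    (winnersLaw k).real {w | ∃ (u : Vertex k) (S : Finset (Vertex k)), u ∈ S ∧
      ConnectedFrom (S : Set (Vertex k)) u ∧ (∀ x ∈ S, (hammingDist u x : ℝ) ≤ R) ∧
      m ≤ S.card ∧ Ev S w} ≤ 2 * Fintype.card (Vertex k) * Real.exp (-(m * b)) := by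
  classical
  have := isProbabilityMeasure_winnersLaw hk
  set D := Fintype.card (Move k)
  set N := Fintype.card (Vertex k)
  have hD : (1 : ℝ) ≤ D := by
    have : Nonempty (Move k) := ⟨⟨⟨0, hn⟩, ⟨0, by have := hk ⟨0, hn⟩; omega⟩⟩⟩
    exact_mod_cast Fintype.card_pos (α := Move k)
  let F : ℕ → Set (Winners k) := fun r => {w | ∃ p : Vertex k ×
    List.Vector (List.Vector (Move k) 1) (2 * (r - 1)), (visited jump p.2.1 p.1).card = r ∧
      (∀ x ∈ visited jump p.2.1 p.1, (hammingDist p.1 x : ℝ) ≤ R) ∧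
      Ev (visited jump p.2.1 p.1) w}
  have hF : ∀ r, (winnersLaw k).real (F r) ≤ N * Real.exp (-b) ^ r := by
    intro r
    -- A connected set of size r is given by a starting point and 2(r - 1) moves, so the entropy per
    -- vertex is the square of the number of moves.
    have h := prob_exists_le hk (A := Vertex k ×
      List.Vector (List.Vector (Move k) 1) (2 * (r - 1)))
      (fun p w => (visited jump p.2.1 p.1).card = r ∧
      (∀ x ∈ visited jump p.2.1 p.1, (hammingDist p.1 x : ℝ) ≤ R) ∧
      Ev (visited jump p.2.1 p.1) w) (c := Real.exp (-a) ^ r) (by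
        rintro ⟨u, l⟩
        by_cases h1 : (visited jump l.1 u).card = r
        · by_cases h2 : ∀ x ∈ visited jump l.1 u, (hammingDist u x : ℝ) ≤ R
          · have h3 := hEv u _ h2
            rw [h1, ← mul_neg, Real.exp_nat_mul] at h3
            refine (prob_mono hk ?_).trans h3
            exact fun w hw => hw.2.2
          · simp only [h2, false_and, and_false]
            simp only [Set.ofPred_false, measureReal_empty]
            positivity
        · simp only [h1, false_and]
          simp only [Set.ofPred_false, measureReal_empty]
          positivity)
    rw [Fintype.card_prod, card_vector, card_vector] at h
    refine h.trans ?_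
    push_cast
    rw [mul_assoc]
    gcongr
    calc ((D : ℝ) ^ 1) ^ (2 * (r - 1)) * Real.exp (-a) ^ r
        ≤ (D : ℝ) ^ (2 * r) * Real.exp (-a) ^ r := by
          rw [pow_one]
          gcongr ?_ * _
          exact pow_le_pow_right₀ hD (by omega)
      _ = ((D : ℝ) ^ 2 * Real.exp (-a)) ^ r := by rw [mul_pow, pow_mul]
      _ ≤ _ := by gcongr
  have hsub : {w | ∃ (u : Vertex k) (S : Finset (Vertex k)), u ∈ S ∧
      ConnectedFrom (S : Set (Vertex k)) u ∧ (∀ x ∈ S, (hammingDist u x : ℝ) ≤ R) ∧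
      m ≤ S.card ∧ Ev S w} ⊆ ⋃ r ∈ Finset.Ico m (N + 1), F r := by
    rintro w ⟨u, S, hu, hS, hR, hm, hw⟩
    obtain ⟨l, hl, rfl⟩ := hS.exists_visited_eq hn hu
    simp only [Set.mem_iUnion]
    refine ⟨_, Finset.mem_Ico.2 ⟨hm, Nat.lt_succ_of_le (Finset.card_le_univ _)⟩,
      ⟨(u, ⟨l, hl⟩), rfl, hR, hw⟩⟩
  -- The ratio of the geometric series is at most 1/2, whence the factor 2 in the conclusion.
  have hexp : Real.exp (-b) ≤ 1 / 2 := by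
    rw [Real.exp_neg, ← one_div]
    have := Real.add_one_le_exp b
    exact one_div_le_one_div_of_le (by norm_num) (by linarith)
  calc _ ≤ _ := prob_mono hk hsub
    _ ≤ _ := measureReal_biUnion_finset_le _ _
    _ ≤ ∑ r ∈ Finset.Ico m (N + 1), N * Real.exp (-b) ^ r := Finset.sum_le_sum fun r _ => hF r
    _ = N * ∑ r ∈ Finset.Ico m (N + 1), Real.exp (-b) ^ r := by rw [Finset.mul_sum]
    _ ≤ N * (Real.exp (-b) ^ m / (1 - Real.exp (-b))) := by
        gcongr
        exact geom_sum_Ico_le_of_lt_one (Real.exp_pos _).le (by linarith)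
    _ ≤ N * (Real.exp (-b) ^ m / (1 / 2)) := by
        gcongr
        linarith
    _ = _ := by
        rw [← mul_neg, Real.exp_nat_mul]
        ring

theorem outClosed_descendants {w : Winners k} {u : Vertex k} {S : Finset (Vertex k)}
    (hS : ∀ z, z ∈ S ↔ CanReach (winnerGraph w) u z) : OutClosed S w := by
  rintro ⟨x, i⟩ hp
  obtain ⟨hx, hp⟩ := mem_singles.1 hp
  by_contra hne
  have hmem : Function.update x i (winCoord w i x) ∈ S :=
    (hS _).2 (((hS x).1 hx).tail (adj_update hne rfl))
  have := congrFun (hp _ hmem (mem_lineThrough.2 fun j hj => by simp [hj])) i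
  rw [Function.update_self] at this
  exact hne this

/-- If `x` won a line meeting `S` only in `x`, every other point of that line would have an edge to
`x` and so be an ancestor too. -/
theorem inClosed_ancestors (hk : ∀ i, 2 ≤ k i) {w : Winners k} {v : Vertex k}
    {S : Finset (Vertex k)} (hS : ∀ z, z ∈ S ↔ CanReach (winnerGraph w) z v) : InClosed S w := by
  rintro ⟨x, i⟩ hp heq
  obtain ⟨hx, hp⟩ := mem_singles.1 hp
  have : Nontrivial (Fin (k i)) := Fin.nontrivial_iff_two_le.2 (hk i)
  obtain ⟨a, ha⟩ := exists_ne (x i)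
  have hadj := adj_update (w := w) (u := Function.update x i a) (a := x i)
    (by simpa using ha.symm) ((winCoord_update w i x a).trans heq)
  rw [Function.update_idem, Function.update_eq_self] at hadj
  have hmem : Function.update x i a ∈ S := (hS _).2 (((hS x).1 hx).head hadj)
  have := congrFun (hp _ hmem (mem_lineThrough.2 fun j hj => by simp [hj])) i
  rw [Function.update_self] at this
  exact ha this

/-! ### Combining the four exceptional events. -/

/-- There is a large separated set of vertices which are not good. -/
def ManyNotGood (w : Winners k) (T : ℕ) : Prop :=
  ∃ (u : Vertex k) (l : List (List.Vector (Move k) 12)), l.length = 2 * T ∧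
    (visited jump l u).card = T + 1 ∧
    ((visited jump l u : Set (Vertex k)).Pairwise fun x y => 12 ≤ hammingDist x y) ∧
    ∀ x ∈ visited jump l u, ¬ Good w x

/-- There is a connected set with at least `m` vertices, contained in a ball of radius `R`, which
satisfies `Ev`. -/
def ExistsConnected (Ev : Finset (Vertex k) → Winners k → Prop) (R : ℝ) (m : ℕ)
    (w : Winners k) : Prop :=
  ∃ (u : Vertex k) (S : Finset (Vertex k)), u ∈ S ∧ ConnectedFrom (S : Set (Vertex k)) u ∧
    (∀ x ∈ S, (hammingDist u x : ℝ) ≤ R) ∧ m ≤ S.card ∧ Ev S w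

theorem ConnectedFrom.exists_good (hn : 0 < n) {w : Winners k} {S : Finset (Vertex k)}
    {u : Vertex k} (hS : ConnectedFrom (S : Set (Vertex k)) u) (hu : u ∈ S) {R : ℝ} {T : ℕ}
    (hT : 12 * T ≤ R) (hR : ¬ ∀ x ∈ S, (hammingDist u x : ℝ) ≤ R) (hw : ¬ ManyNotGood w T) :
    ∃ x ∈ S, Good w x := by
  push Not at hR
  obtain ⟨z, hz, hzR⟩ := hR
  obtain ⟨l, hl, h1, h2, h3⟩ := hS.exists_separated hn hu (d := 12) (T := T) hz
    (by exact_mod_cast (hT.trans hzR.le)) (by norm_num)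
  by_contra hbad
  push Not at hbad
  exact hw ⟨u, l, hl, h2, h3, fun x hx => hbad x (h1 hx)⟩

theorem wellConnected_of_not_exceptional (hk : ∀ i, 2 ≤ k i) (hn : 0 < n) {w : Winners k}
    {R M : ℝ} {T m : ℕ} (hT : 12 * T ≤ R) (hm : ∀ r : ℕ, M < r → m ≤ r)
    (h1 : ¬ ExistsConnected OutClosed R 2 w) (h2 : ¬ ExistsConnected InClosed R m w)
    (h3 : ¬ ManyNotGood w T)
    (h4 : ¬ ∃ x y, Good w x ∧ Good w y ∧ ¬ CanReach (winnerGraph w) x y) :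
    WellConnected (winnerGraph w) M := by
  classical
  intro v
  by_cases hv : ({u | CanReach (winnerGraph w) u v}.ncard : ℝ) ≤ M
  · exact Or.inl hv
  right
  intro u hu
  set A : Finset (Vertex k) := {z | CanReach (winnerGraph w) z v}.toFinset
  set D : Finset (Vertex k) := {z | CanReach (winnerGraph w) u z}.toFinset
  have hA : ∀ z, z ∈ A ↔ CanReach (winnerGraph w) z v := by simp [A]
  have hD : ∀ z, z ∈ D ↔ CanReach (winnerGraph w) u z := by simp [D]
  have hvA : v ∈ A := (hA v).2 Relation.ReflTransGen.refl
  have huD : u ∈ D := (hD u).2 Relation.ReflTransGen.refl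
  have hAc : ConnectedFrom (A : Set (Vertex k)) v := by
    simpa [A] using connectedFrom_ancestors w v
  have hDc : ConnectedFrom (D : Set (Vertex k)) u := by
    simpa [D] using connectedFrom_descendants w u
  obtain ⟨y, hy, hyg⟩ := hAc.exists_good hn hvA hT (fun hR => h2 ⟨v, A, hvA, hAc, hR, hm _ (by
    rw [Set.ncard_eq_toFinset_card', not_le] at hv
    exact hv), inClosed_ancestors hk hA⟩) h3
  -- A non-sink has an out-neighbour, hence at least two descendants; for a sink the bound with 2
  -- vertices would not apply.
  obtain ⟨x, hx, hxg⟩ := hDc.exists_good hn huD hT (fun hR => h1 ⟨u, D, huD, hDc, hR, by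
    unfold IsSink at hu
    push Not at hu
    obtain ⟨u', hu'⟩ := hu
    obtain ⟨i, hi, hne⟩ := exists_eq_update_of_adj hu'
    refine Finset.one_lt_card.2 ⟨u, huD, u', (hD u').2 (Relation.ReflTransGen.single hu'), ?_⟩
    intro h
    have := congrFun hi i
    rw [Function.update_self, ← h] at this
    exact hne this.symm, outClosed_descendants hD⟩) h3
  push Not at h4
  exact (((hD x).1 hx).trans (h4 x y hxg hyg)).trans ((hA y).1 hy)

theorem prob_not_wellConnected_le (hk : ∀ i, 2 ≤ k i) (hn : 0 < n) {R M : ℝ} {T m : ℕ}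
    (hT : 12 * T ≤ R) (hm : ∀ r : ℕ, M < r → m ≤ r) :
    (winnersLaw k).real {w | ¬ WellConnected (winnerGraph w) M} ≤
      (winnersLaw k).real {w | ExistsConnected OutClosed R 2 w} +
      (winnersLaw k).real {w | ExistsConnected InClosed R m w} +
      (winnersLaw k).real {w | ManyNotGood w T} +
      (winnersLaw k).real
        {w | ∃ x y, Good w x ∧ Good w y ∧ ¬ CanReach (winnerGraph w) x y} := by
  have := isProbabilityMeasure_winnersLaw hk
  refine (prob_mono hk (F := (({w | ExistsConnected OutClosed R 2 w} ∪
    {w | ExistsConnected InClosed R m w}) ∪ {w | ManyNotGood w T}) ∪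
    {w | ∃ x y, Good w x ∧ Good w y ∧ ¬ CanReach (winnerGraph w) x y}) fun w hw => ?_).trans ?_
  · by_contra h
    simp only [Set.mem_union, Set.mem_ofPred_eq, not_or] at h
    exact hw (wellConnected_of_not_exceptional hk hn hT hm h.1.1.1 h.1.1.2 h.1.2 h.2)
  · refine (measureReal_union_le _ _).trans (add_le_add_left ?_ _)
    refine (measureReal_union_le _ _).trans (add_le_add_left ?_ _)
    exact measureReal_union_le _ _

/-! ### Numerical estimates. -/

theorem card_vertex_eq_exp (hk : ∀ i, 2 ≤ k i) :
    (Fintype.card (Vertex k) : ℝ) = Real.exp (∑ i, Real.log (k i)) := by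
  rw [Real.exp_sum, Fintype.card_pi]
  push_cast
  refine Finset.prod_congr rfl fun i _ => ?_
  rw [Fintype.card_fin, Real.exp_log]
  have := hk i
  positivity

theorem card_move_le {K : ℕ} (hK : ∀ i, k i ≤ K) : Fintype.card (Move k) ≤ n * K := by
  rw [Fintype.card_sigma]
  refine (Finset.sum_le_card_nsmul _ _ K fun i _ => ?_).trans (by simp)
  rw [Fintype.card_fin]
  exact hK i

theorem prob_existsConnected_outClosed_le (hk : ∀ i, 2 ≤ k i) {K : ℕ} (hK : ∀ i, k i ≤ K)
    (hn : 0 < n) {R a b : ℝ} (ha : a ≤ ∑ i, Real.log (k i) - 2 * R * Real.log K) (hb : 1 ≤ b)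
    (hab : (Fintype.card (Move k) : ℝ) ^ 2 * Real.exp (-a) ≤ Real.exp (-b)) (m : ℕ) :
    (winnersLaw k).real {w | ExistsConnected OutClosed R m w} ≤
      2 * Fintype.card (Vertex k) * Real.exp (-(m * b)) := by
  refine prob_exists_connected_le hk hn OutClosed hb (fun u S hS => ?_) hab m
  refine (prob_outClosed_le hk S).trans (Real.exp_le_exp.2 (neg_le_neg ?_))
  refine le_trans ?_ (sum_singles_ge hS (fun i => Real.log (k i)) (Real.log_natCast_nonneg K)
    fun i => ?_)
  · gcongr
  · have h1 := hk i
    exact Real.log_le_log (by positivity) (by exact_mod_cast hK i)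

theorem prob_existsConnected_inClosed_le (hk : ∀ i, 2 ≤ k i) {K : ℕ} (hK : ∀ i, k i ≤ K)
    (hn : 0 < n) {R a b : ℝ}
    (ha : a ≤ (∑ i, Real.log (k i) - 2 * R * Real.log K) / (K * Real.log K)) (hb : 1 ≤ b)
    (hab : (Fintype.card (Move k) : ℝ) ^ 2 * Real.exp (-a) ≤ Real.exp (-b)) (m : ℕ) :
    (winnersLaw k).real {w | ExistsConnected InClosed R m w} ≤
      2 * Fintype.card (Vertex k) * Real.exp (-(m * b)) := by
  refine prob_exists_connected_le hk hn InClosed hb (fun u S hS => ?_) hab m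
  refine (prob_inClosed_le hk hK S).trans (Real.exp_le_exp.2 (neg_le_neg ?_))
  have hlog : 0 ≤ Real.log K := Real.log_natCast_nonneg K
  refine le_trans ?_ (div_le_div_of_nonneg_right
    (sum_singles_ge hS (fun i => Real.log (k i)) hlog fun i => ?_) (by positivity))
  · rw [mul_div_assoc]
    gcongr
  · have h1 := hk i
    exact Real.log_le_log (by positivity) (by exact_mod_cast hK i)

/-- The failure probability, in terms of `l = log n` and `Λ = log (∏ i, k i)`. -/
theorem prob_not_wellConnected_le_exp (hk : ∀ i, 2 ≤ k i) {K : ℕ} (hK : ∀ i, k i ≤ K)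
    (hn : 4 ≤ n) (hKn : K ≤ n) {ε e l Λ : ℝ} (he0 : 0 < e) (he1 : e ≤ 1) (hee : e ≤ ε)
    (hl : l = Real.log n) (hΛ : Λ = ∑ i, Real.log (k i))
    (h1 : 32 * l * (K * Real.log K) ≤ e * Λ) (h2 : 900 * K ^ 2 * l ≤ e * (n - 1)) :
    (winnersLaw k).real {w | ¬ WellConnected (winnerGraph w) ((1 + ε) * K * Real.log K)} ≤
      Real.exp (-(e / 4 * Λ)) := by
  have hn0 : 0 < n := by omega
  have hnR : (4 : ℝ) ≤ n := by exact_mod_cast hn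
  have hK2 : 2 ≤ K := (hk ⟨0, hn0⟩).trans (hK _)
  have hK2R : (2 : ℝ) ≤ K := by exact_mod_cast hK2
  have hl1 : 0.69 < l := by
    rw [hl]
    have := Real.log_two_gt_d9
    have := Real.log_le_log (by norm_num) (show (2 : ℝ) ≤ n by linarith)
    linarith
  have hnexp : (n : ℝ) = Real.exp l := by rw [hl, Real.exp_log (by linarith)]
  have hlK : Real.log K ≤ l := by
    rw [hl]
    exact Real.log_le_log (by linarith) (by exact_mod_cast hKn)
  have hlK0 : 0.69 < Real.log K := by
    have := Real.log_two_gt_d9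
    have := Real.log_le_log (by norm_num) hK2R
    linarith
  set κ : ℝ := K * Real.log K with hκ
  have hκ1 : 1 ≤ κ := by nlinarith
  have hΛκ : 32 * l ≤ e * (Λ / κ) := by
    rw [← mul_div_assoc, le_div_iff₀ (by linarith)]
    exact h1
  have hlκ : 32 * l ≤ 32 * l * κ := le_mul_of_one_le_right (by linarith) hκ1
  have hΛ32 : 32 * l ≤ e * Λ := hlκ.trans h1
  have hΛ0 : 0 < Λ := by
    by_contra h
    have := mul_nonpos_of_nonneg_of_nonpos he0.le (not_lt.1 h)
    linarith
  have hΛle : Λ ≤ n * l := by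
    rw [hΛ]
    refine (Finset.sum_le_card_nsmul _ _ l fun i _ => ?_).trans (by simp)
    refine le_trans (Real.log_le_log ?_ ?_) hlK
    · have := hk i
      positivity
    · exact_mod_cast hK i
  have hN : (Fintype.card (Vertex k) : ℝ) = Real.exp Λ := by rw [hΛ, card_vertex_eq_exp hk]
  have hD : (Fintype.card (Move k) : ℝ) ≤ Real.exp (2 * l) := by
    calc (Fintype.card (Move k) : ℝ) ≤ n * K := by exact_mod_cast card_move_le hK
      _ ≤ n * n := by gcongr
      _ = Real.exp (2 * l) := by rw [hnexp, ← Real.exp_add]; ring_nf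
  -- This radius loses only (e/8)Λ in `sum_singles_ge`, yet leaves of order Λ / log n separated
  -- vertices outside the ball.
  set R : ℝ := e / 16 * Λ / l with hR
  have hR0 : 0 ≤ R := by positivity
  have hRK : 2 * R * Real.log K ≤ e / 8 * Λ := by
    calc 2 * R * Real.log K ≤ 2 * R * l := by gcongr
      _ = e / 8 * Λ := by
        rw [hR]
        field_simp
        ring
  set T : ℕ := ⌊R / 12⌋₊ with hT
  have hTR : 12 * (T : ℝ) ≤ R := by
    have := Nat.floor_le (show 0 ≤ R / 12 by positivity)
    linarith
  have hTR' : e / 192 * Λ ≤ l * (T + 1) := by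
    have h3 := (Nat.lt_floor_add_one (R / 12)).le
    have h4 := mul_le_mul_of_nonneg_left h3 (show 0 ≤ l by linarith)
    have h5 : l * (R / 12) = e / 192 * Λ := by
      rw [hR]
      field_simp
      ring
    rw [← h5]
    exact h4
  have hm : ∀ r : ℕ, (1 + ε) * K * Real.log K < r → ⌊(1 + ε) * κ⌋₊ + 1 ≤ r := by
    intro r hr
    refine Nat.succ_le_of_lt ((Nat.floor_lt (mul_nonneg (by linarith) (by linarith))).2 ?_)
    rwa [hκ, ← mul_assoc]
  refine (prob_not_wellConnected_le hk hn0 hTR hm).trans ?_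
  -- There are at most n² moves, so counting walks costs 4 log n per vertex; `hΛ32` and `hΛκ` make
  -- this at most e/8 of the main term.
  have hab : ∀ {a b : ℝ}, b + 4 * l ≤ a →
      (Fintype.card (Move k) : ℝ) ^ 2 * Real.exp (-a) ≤ Real.exp (-b) := by
    intro a b hab
    calc (Fintype.card (Move k) : ℝ) ^ 2 * Real.exp (-a)
        ≤ Real.exp (2 * l) ^ 2 * Real.exp (-a) := by gcongr
      _ = Real.exp (4 * l - a) := by
        rw [← Real.exp_nat_mul, ← Real.exp_add]
        push_cast
        ring_nf
      _ ≤ _ := Real.exp_le_exp.2 (by linarith)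
  have heΛ : e * Λ ≤ Λ := mul_le_of_le_one_left hΛ0.le he1
  have hexp : ∀ {x : ℝ}, e / 2 * Λ ≤ x → Real.exp (-x) ≤ Real.exp (-(e / 2 * Λ)) :=
    fun h => Real.exp_le_exp.2 (neg_le_neg h)
  have hE1 : (winnersLaw k).real {w | ExistsConnected OutClosed R 2 w} ≤
      2 * Real.exp (-(e / 2 * Λ)) := by
    refine (prob_existsConnected_outClosed_le hk hK hn0 (R := R) (a := Λ - e / 8 * Λ)
      (b := Λ - e / 4 * Λ) (by rw [← hΛ]; linarith) (by linarith)
      (hab (by linarith)) 2).trans ?_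
    rw [hN, mul_assoc, ← Real.exp_add]
    refine mul_le_mul_of_nonneg_left (Real.exp_le_exp.2 ?_) (by norm_num)
    push_cast
    linarith
  have hE2 : (winnersLaw k).real {w | ExistsConnected InClosed R (⌊(1 + ε) * κ⌋₊ + 1) w} ≤
      2 * Real.exp (-(e / 2 * Λ)) := by
    have heκ : e * (Λ / κ) ≤ Λ / κ := mul_le_of_le_one_left (by positivity) he1
    refine (prob_existsConnected_inClosed_le hk hK hn0 (R := R) (a := (1 - e / 8) * (Λ / κ))
      (b := (1 - e / 4) * (Λ / κ)) ?_ (by linarith) (hab (by linarith)) _).trans ?_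
    · rw [← mul_div_assoc, ← hΛ]
      exact div_le_div_of_nonneg_right (by linarith) (by linarith)
    · rw [hN, mul_assoc, ← Real.exp_add]
      refine mul_le_mul_of_nonneg_left (Real.exp_le_exp.2 ?_) (by norm_num)
      have h3 : (1 + e) * κ ≤ ((⌊(1 + ε) * κ⌋₊ + 1 : ℕ) : ℝ) := by
        push_cast
        refine le_trans ?_ (Nat.lt_floor_add_one _).le
        gcongr
      have h4 : (1 + e) * κ * ((1 - e / 4) * (Λ / κ)) ≤
          ((⌊(1 + ε) * κ⌋₊ + 1 : ℕ) : ℝ) * ((1 - e / 4) * (Λ / κ)) :=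
        mul_le_mul_of_nonneg_right h3 (mul_nonneg (by linarith) (by positivity))
      -- The surplus 3e/4 - e²/4 over 1 is at least e/2, which pays for the choice of starting point
      -- and leaves exp(-(e/2)Λ).
      have h5 : (1 + e) * κ * ((1 - e / 4) * (Λ / κ)) = (1 + 3 / 4 * e - e * e / 4) * Λ := by
        field_simp
        ring
      have h6 : e * e * Λ ≤ e * Λ := by
        rw [mul_assoc]
        exact mul_le_mul_of_nonneg_left heΛ he0.le
      rw [h5] at h4
      linarith
  -- The exponent `C` of the failure probability of all detours must be of order 1/e, since there
  -- are only about eΛ/(192 log n) separated vertices to beat exp Λ.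
  set C : ℝ := 450 / e with hC
  have hCe : e * C = 450 := by rw [hC]; field_simp
  have hC450 : 450 ≤ C := by rw [hC, le_div_iff₀ he0]; linarith
  have hq : ∀ (y : Vertex k) i a, a ≠ y i →
      (winnersLaw k).real {w | ¬ Linked w y i a} ≤ Real.exp (-(C * l)) := by
    intro y i a ha
    refine (prob_not_linked_le hk hK y ha).trans (Real.exp_le_exp.2 (neg_le_neg ?_))
    rw [le_div_iff₀ (by positivity), hC, div_mul_eq_mul_div, div_mul_eq_mul_div,
      div_le_iff₀ he0]
    linarith
  have hE3 : (winnersLaw k).real {w | ManyNotGood w T} ≤ Real.exp (-(e / 2 * Λ)) := by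
    have hbad : ∀ x : Vertex k, (winnersLaw k).real {w | ¬ Good w x} ≤
        Real.exp ((10 - C) * l) := by
      intro x
      refine (prob_not_good_le hk (Real.exp_pos _).le hq hn0 x).trans ?_
      calc (Fintype.card (Move k) : ℝ) ^ 5 * Real.exp (-(C * l))
          ≤ Real.exp (2 * l) ^ 5 * Real.exp (-(C * l)) := by gcongr
        _ = Real.exp ((10 - C) * l) := by
          rw [← Real.exp_nat_mul, ← Real.exp_add]
          push_cast
          ring_nf
    refine (prob_exists_not_good_le hk (Real.exp_pos _).le hbad T).trans ?_
    calc _ ≤ Real.exp Λ * ((Real.exp (2 * l) ^ 24) ^ (T + 1) *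
          Real.exp ((10 - C) * l) ^ (T + 1)) := by
          rw [hN]
          gcongr ?_ * (?_ * ?_)
          refine (pow_le_pow_left₀ (by positivity)
            (pow_le_pow_left₀ (by positivity) hD 24) T).trans ?_
          exact pow_le_pow_right₀ (one_le_pow₀ (Real.one_le_exp (by linarith))) (by omega)
      _ = Real.exp (Λ - (C - 58) * (l * (T + 1))) := by
          rw [← Real.exp_nat_mul, ← Real.exp_nat_mul, ← Real.exp_nat_mul, ← Real.exp_add,
            ← Real.exp_add]
          push_cast
          ring_nf
      _ ≤ _ := by
          refine Real.exp_le_exp.2 ?_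
          have h3 := mul_le_mul_of_nonneg_left hTR' (show 0 ≤ C - 58 by linarith)
          -- Here 58 = 10 + 48: at most n^10 from the edges near a vertex and n^48 from 24 moves per
          -- separated vertex. As e ≤ 1, the coefficient is at least 392/192 > 2.
          have h4 : (C - 58) * (e / 192 * Λ) = (e * C - 58 * e) / 192 * Λ := by ring
          rw [h4, hCe] at h3
          linarith
  have hE4 : (winnersLaw k).real
      {w | ∃ x y, Good w x ∧ Good w y ∧ ¬ CanReach (winnerGraph w) x y} ≤
      Real.exp (-(e / 2 * Λ)) := by
    refine (prob_exists_good_not_canReach_le hk (Real.exp_pos _).le hq).trans ?_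
    have h3 : (n : ℝ) / 8 ≤ (n / 4 : ℕ) := by
      have h5 : n ≤ 8 * (n / 4) := by omega
      have h6 : (n : ℝ) ≤ 8 * (n / 4 : ℕ) := by exact_mod_cast h5
      linarith
    have h4 : (n : ℝ) * Real.exp (-(C * l)) = Real.exp (-((C - 1) * l)) := by
      rw [hnexp, ← Real.exp_add]
      ring_nf
    rw [h4, hN, ← Real.exp_nat_mul, ← Real.exp_nat_mul, ← Real.exp_add]
    refine Real.exp_le_exp.2 ?_
    have h5 : n / 8 * ((C - 1) * l) ≤ (n / 4 : ℕ) * ((C - 1) * l) :=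
      mul_le_mul_of_nonneg_right h3 (mul_nonneg (by linarith) (by linarith))
    have h6 : 449 * (n * l) ≤ (C - 1) * (n * l) :=
      mul_le_mul_of_nonneg_right (by linarith) (by positivity)
    push_cast at h5 ⊢
    linarith
  -- The four bounds add up to 2 + 2 + 1 + 1 = 6 copies; (e/4)Λ ≥ 8 log n > 5 absorbs the factor.
  have h6 : 6 * Real.exp (-(e / 2 * Λ)) ≤ Real.exp (-(e / 4 * Λ)) := by
    have h7 : Real.exp (-(e / 4 * Λ)) = Real.exp (e / 4 * Λ) * Real.exp (-(e / 2 * Λ)) := by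
      rw [← Real.exp_add]
      ring_nf
    rw [h7]
    refine mul_le_mul_of_nonneg_right ?_ (Real.exp_pos _).le
    have := Real.add_one_le_exp (e / 4 * Λ)
    linarith
  linarith

end DirectedGrid

/-! ### Choice of constants. -/

theorem mainTheorem2 (ε : ℝ) (hε : 0 < ε) :
    ∃ c δ : ℝ, 0 < c ∧ 0 < δ ∧
      ∀ (n : ℕ) (k : Fin n → ℕ) (K : ℕ), 2 ≤ n → (∀ i, 2 ≤ k i) → K = Finset.univ.sup k →
        (K : ℝ) ≤ δ * Real.sqrt ((n : ℝ) / Real.log n) →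
        DirectedGrid.winnersLaw k
            {w | ¬ DirectedGrid.WellConnected (DirectedGrid.winnerGraph w)
              ((1 + ε) * K * Real.log K)} ≤
          ENNReal.ofReal (∏ i, (k i : ℝ) ^ (-c)) := by
  set e : ℝ := min ε 1 with he
  have he0 : 0 < e := lt_min hε one_pos
  have he1 : e ≤ 1 := min_le_right _ _
  refine ⟨e / 4, e / 200, by positivity, by positivity, fun n k K hn hk hK hle => ?_⟩
  have := DirectedGrid.isProbabilityMeasure_winnersLaw hk
  have hkK : ∀ i, k i ≤ K := fun i => hK ▸ Finset.le_sup (Finset.mem_univ i)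
  have hK2 : (2 : ℝ) ≤ K := by exact_mod_cast (hk ⟨0, by omega⟩).trans (hkK _)
  have hn2 : (2 : ℝ) ≤ n := by exact_mod_cast hn
  have hlog2 := Real.log_two_gt_d9
  set l : ℝ := Real.log n with hl
  have hl2 : Real.log 2 ≤ l := Real.log_le_log (by norm_num) hn2
  have hl0 : 0 < l := by linarith
  have hKl : (K : ℝ) ^ 2 * l ≤ (e / 200) ^ 2 * n := by
    have h1 : (K : ℝ) ^ 2 ≤ (e / 200 * Real.sqrt (n / l)) ^ 2 := by gcongr
    rw [mul_pow, Real.sq_sqrt (by positivity), ← mul_div_assoc, le_div_iff₀ hl0] at h1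
    exact h1
  have hee : e * e ≤ e := mul_le_of_le_one_left he0.le he1
  have heen : e * e * n ≤ e * n := mul_le_mul_of_nonneg_right hee (by linarith)
  have hen : e * n ≤ n := mul_le_of_le_one_left (by linarith) he1
  have hKK : 2 * (K : ℝ) ≤ K ^ 2 := by rw [pow_two]; gcongr
  have hK2l : (K : ℝ) ^ 2 * 0.69 ≤ K ^ 2 * l := by gcongr; linarith
  have hn4 : 4 ≤ n := by
    have : (4 : ℝ) ≤ n := by linarith
    exact_mod_cast this
  have hn4' : (4 : ℝ) ≤ n := by exact_mod_cast hn4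
  have hKn : K ≤ n := by
    have : (K : ℝ) ≤ n := by linarith
    exact_mod_cast this
  have hlK : Real.log K ≤ l := Real.log_le_log (by linarith) (by exact_mod_cast hKn)
  have hΛ : 0.69 * n ≤ ∑ i, Real.log (k i) := by
    have h := Finset.card_nsmul_le_sum Finset.univ (fun i => Real.log (k i)) 0.69 fun i _ => by
      have h2 : (2 : ℝ) ≤ k i := by exact_mod_cast hk i
      have := Real.log_le_log (by norm_num) h2
      linarith
    rw [Finset.card_univ, Fintype.card_fin, nsmul_eq_mul] at h
    linarith
  have hl3 : l ^ 3 ≤ 6 * n := by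
    have h := Real.pow_div_factorial_le_exp l hl0.le 3
    rw [hl, Real.exp_log (by linarith), ← hl, div_le_iff₀ (by positivity)] at h
    norm_num [Nat.factorial] at h
    linarith
  -- Squaring splits the left side into K² log n, bounded by hypothesis, and (log n)³, bounded by
  -- the exponential series; 6 ≤ 3² suffices. This yields K log K log n ≪ eΛ, as Λ ≥ 0.69 n.
  have hKll : (K : ℝ) * l ^ 2 ≤ 3 * e / 200 * n := by
    refine le_of_sq_le_sq ?_ (by positivity)
    calc ((K : ℝ) * l ^ 2) ^ 2 = K ^ 2 * l * l ^ 3 := by ring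
      _ ≤ (e / 200) ^ 2 * n * (6 * n) := by gcongr
      _ ≤ (3 * e / 200 * n) ^ 2 := by
        have : 0 ≤ (e / 200 * n) ^ 2 := sq_nonneg _
        linarith
  have hmain := DirectedGrid.prob_not_wellConnected_le_exp hk hkK hn4 hKn he0 he1
    (min_le_left ε 1) hl rfl (by
      have h1 : 32 * l * (K * Real.log K) ≤ 32 * l * (K * l) := by gcongr
      have h2 := mul_le_mul_of_nonneg_left hΛ he0.le
      have h3 : 0 ≤ e * n := by positivity
      linarith) (by
      have h4 : e * 4 ≤ e * n := mul_le_mul_of_nonneg_left hn4' he0.le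
      linarith)
  rw [← ofReal_measureReal]
  refine ENNReal.ofReal_le_ofReal (hmain.trans_eq ?_)
  rw [Finset.mul_sum, ← Finset.sum_neg_distrib, Real.exp_sum]
  refine Finset.prod_congr rfl fun i _ => ?_
  rw [Real.rpow_def_of_pos (by have := hk i; positivity)]
  ring_nf
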